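/- **Conventions.** For a finitely generated free abelian group $V$ let $\top$ be the involution of $\operatorname{Hom}(V,V^*)$ given by $(\top\varphi)(x)(y)=\varphi(y)(x)$, and let $Q_+(V)=\operatorname{coker}(1-\top)$. A quadratic form $(V,\psi)$, $\psi\in Q_+(V)$, has symmetrisation $\lambda=(1+\top)\psi$ with adjoint $\widehat\lambda\colon V\to V^*$; it is nondegenerate if $\widehat\lambda$ is injective. $\operatorname{Aut}(V,\psi)$ is the group of automorphisms $h$ of $V$ with $h^*\psi h=\psi$ in $Q_+(V)$. For nondegenerate $(V,\psi)$ the boundary $\partial(V,\psi)$ is the finite group $\operatorname{coker}\widehat\lambda$ with the symmetric bilinear form $\partial\lambda([x],[y])=\frac1s\,y(z)\in\mathbb{Q}/\mathbb{Z}$ and the quadratic refinement $\partial\psi([x])=\frac1{s^2}\psi(z,z)\in\mathbb{Q}/\mathbb{Z}$, where $s\in\mathbb{Z}\setminus\{0\}$ and $z\in V$ satisfy $sx=\widehat\lambda(z)$. $\operatorname{Aut}(\partial(V,\psi))$ is the group of automorphisms of $\operatorname{coker}\widehat\lambda$ preserving both. The boundary map is the homomorphism $\partial\colon\operatorname{Aut}(V,\psi)\to\operatorname{Aut}(\partial(V,\psi))$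 with $\partial h$ induced by $(h^*)^{-1}$. Finally $\operatorname{bAut}(V,\psi)$ is the set of orbits of the action $(h,g)\cdot f=\partial h\circ f\circ(\partial g)^{-1}$ of $\operatorname{Aut}(V,\psi)\times\operatorname{Aut}(V,\psi)$ on $\operatorname{Aut}(\partial(V,\psi))$; it is trivial if it has exactly one element. **Proposition.** For $h\in\{6,7\}$ and either choice of sign, let $V=\mathbb{Z}^h$ and let $2\theta\in Q_+(\mathbb{Z}^h)$ be the nondegenerate class represented by $$\pm\begin{pmatrix}4&4&4&\cdots&4\\0&2&2&\cdots&2\\0&0&2&\cdots&2\\ \vdots&&&\ddots&\vdots\\0&0&0&\cdots&2\end{pmatrix}.$$ Then the set $\operatorname{bAut}(V,2\theta)$ is non-trivial, and the boundary map $\partial\colon\operatorname{Aut}(V,2\theta)\to\operatorname{Aut}(\partial(V,2\theta))$ is not surjective. More precisely, the image of $\partial$ is a subgroup of $\operatorname{Aut}(\partial(V,2\theta))$ of index $2$ if $h=6$ and of index $8$ if $h=7$. -/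

import Mathlib

noncomputable section

namespace BoundaryForms

/-! ### Quadratic and symmetric `Q`-groups, quadratic forms over the integers -/

section QuadraticForms

variable {V : Type*} [AddCommGroup V]

/-- The involution `⊤` of `Hom(V, V*)`, sending `φ` to `x ↦ (y ↦ φ y x)`. -/
def transpose (V : Type*) [AddCommGroup V] :
    (V →ₗ[ℤ] Module.Dual ℤ V) →ₗ[ℤ] (V →ₗ[ℤ] Module.Dual ℤ V) :=
  LinearMap.lflip.toLinearMap

@[simp] theorem transpose_apply (φ : V →ₗ[ℤ] Module.Dual ℤ V) (x y : V) :
    transpose V φ x y = φ y x := rfl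

/-- The quadratic `Q`-group `Q_+(V) = coker (1 - ⊤)`. -/
abbrev QuadraticQ (V : Type*) [AddCommGroup V] : Type _ :=
  (V →ₗ[ℤ] Module.Dual ℤ V) ⧸ LinearMap.range (LinearMap.id - transpose V)

/-- The symmetric `Q`-group `Q^+(V) = ker (1 - ⊤)`. -/
abbrev SymmetricQ (V : Type*) [AddCommGroup V] :
    Submodule ℤ (V →ₗ[ℤ] Module.Dual ℤ V) :=
  LinearMap.ker (LinearMap.id - transpose V)

/-- The class in `Q_+(V)` of a homomorphism `V → V*`. -/
abbrev QuadraticQ.mk (φ : V →ₗ[ℤ] Module.Dual ℤ V) : QuadraticQ V :=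
  Submodule.Quotient.mk φ

/-- The symmetrisation map `1 + ⊤ : Q_+(V) → Q^+(V)`. -/
def symmetrisation (V : Type*) [AddCommGroup V] : QuadraticQ V →ₗ[ℤ] SymmetricQ V :=
  Submodule.liftQ _
    (LinearMap.codRestrict (SymmetricQ V) (LinearMap.id + transpose V) (by
      intro φ
      rw [LinearMap.mem_ker]
      ext x y
      simpa using sub_eq_zero.mpr (add_comm (φ x y) (φ y x))))
    (by
      rintro _ ⟨φ, rfl⟩
      rw [LinearMap.mem_ker]
      ext x y
      simp [add_comm (φ x y)])

/-- The adjoint `λ^ : V → V*` of the symmetrisation `λ` of `ψ`. -/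
def adjoint (ψ : QuadraticQ V) : V →ₗ[ℤ] Module.Dual ℤ V := (symmetrisation V ψ).1

/-- The value `θ(z, z)`, which only depends on the class of `θ` in `Q_+(V)`. -/
def quadValue (z : V) : QuadraticQ V →ₗ[ℤ] ℤ :=
  Submodule.liftQ _ ((LinearMap.applyₗ z).comp (LinearMap.applyₗ z))
    (by
      rintro _ ⟨φ, rfl⟩
      rw [LinearMap.mem_ker]
      simp)

/-- The pullback `h^* ψ h`. -/
def pullback {W : Type*} [AddCommGroup W] (h : W →ₗ[ℤ] V) : QuadraticQ V →ₗ[ℤ] QuadraticQ W :=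
  Submodule.mapQ _ _ ((LinearMap.lcomp ℤ (Module.Dual ℤ W) h).comp
      (LinearMap.llcomp ℤ V (Module.Dual ℤ V) (Module.Dual ℤ W) h.dualMap))
    (by
      rintro _ ⟨φ, rfl⟩
      exact ⟨h.dualMap.comp (φ.comp h), by ext x y; simp⟩)

@[simp] theorem adjoint_mk (φ : V →ₗ[ℤ] Module.Dual ℤ V) (x y : V) :
    adjoint (QuadraticQ.mk φ) x y = φ x y + φ y x := rfl

@[simp] theorem quadValue_mk (φ : V →ₗ[ℤ] Module.Dual ℤ V) (z : V) :
    quadValue z (QuadraticQ.mk φ) = φ z z := rfl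

@[simp] theorem pullback_mk {W : Type*} [AddCommGroup W] (h : W →ₗ[ℤ] V)
    (φ : V →ₗ[ℤ] Module.Dual ℤ V) :
    pullback h (QuadraticQ.mk φ) = QuadraticQ.mk (h.dualMap.comp (φ.comp h)) := rfl

theorem adjoint_comm (ψ : QuadraticQ V) (x y : V) : adjoint ψ x y = adjoint ψ y x := by
  induction ψ using Submodule.Quotient.induction_on with
  | H φ => exact add_comm _ _

theorem quadValue_add (ψ : QuadraticQ V) (x y : V) :
    quadValue (x + y) ψ = quadValue x ψ + quadValue y ψ + adjoint ψ x y := by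
  induction ψ using Submodule.Quotient.induction_on with
  | H φ =>
    change φ (x + y) (x + y) = φ x x + φ y y + (φ x y + φ y x)
    simp only [map_add, LinearMap.add_apply]
    ring

theorem quadValue_smul (ψ : QuadraticQ V) (r : ℤ) (x : V) :
    quadValue (r • x) ψ = r ^ 2 * quadValue x ψ := by
  induction ψ using Submodule.Quotient.induction_on with
  | H φ =>
    change φ (r • x) (r • x) = r ^ 2 * φ x x
    simp only [map_smul, LinearMap.smul_apply, smul_eq_mul]
    ring

theorem quadValue_pullback {W : Type*} [AddCommGroup W] (h : W →ₗ[ℤ] V) (ψ : QuadraticQ V)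
    (x : W) : quadValue x (pullback h ψ) = quadValue (h x) ψ := by
  induction ψ using Submodule.Quotient.induction_on with
  | H φ => rfl

theorem adjoint_pullback {W : Type*} [AddCommGroup W] (h : W →ₗ[ℤ] V) (ψ : QuadraticQ V)
    (x y : W) : adjoint (pullback h ψ) x y = adjoint ψ (h x) (h y) := by
  induction ψ using Submodule.Quotient.induction_on with
  | H φ => rfl

theorem pullback_comp {W U : Type*} [AddCommGroup W] [AddCommGroup U] (g : U →ₗ[ℤ] W)
    (h : W →ₗ[ℤ] V) (ψ : QuadraticQ V) :
    pullback (h ∘ₗ g) ψ = pullback g (pullback h ψ) := by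
  induction ψ using Submodule.Quotient.induction_on with
  | H φ => rfl

theorem pullback_id (ψ : QuadraticQ V) : pullback LinearMap.id ψ = ψ := by
  induction ψ using Submodule.Quotient.induction_on with
  | H φ => rfl

/-- A quadratic form is nondegenerate if the adjoint of its symmetrisation is injective. -/
def Nondegenerate (ψ : QuadraticQ V) : Prop := Function.Injective (adjoint ψ)

/-- `Aut(V, ψ)`: the group of isometries of the quadratic form `(V, ψ)`, i.e. of automorphisms `h`
of `V` with `h^* ψ h = ψ` in `Q_+(V)`. -/
def Aut (ψ : QuadraticQ V) : Subgroup (V ≃ₗ[ℤ] V) where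
  carrier := {h | pullback h.toLinearMap ψ = ψ}
  one_mem' := pullback_id ψ
  mul_mem' := by
    intro g h hg hh
    change pullback (g.toLinearMap ∘ₗ h.toLinearMap) ψ = ψ
    rw [pullback_comp, hg, hh]
  inv_mem' := by
    intro h hh
    change pullback h.symm.toLinearMap ψ = ψ
    conv_lhs => rw [← show pullback h.toLinearMap ψ = ψ from hh]
    rw [← pullback_comp]
    simpa using pullback_id ψ

end QuadraticForms

/-! ### Linking forms -/

/-- The group `ℚ / ℤ`. -/
abbrev QmodZ : Type := AddCircle (1 : ℚ)

/-- A symmetric linking form on the finite abelian group `T`. -/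
structure SymmetricLinkingForm (T : Type*) [AddCommGroup T] where
  finite : Finite T
  b : T →+ T →+ QmodZ
  symm : ∀ x y, b x y = b y x

/-- A split quadratic linking form on the finite abelian group `T`. -/
structure SplitQuadraticLinkingForm (T : Type*) [AddCommGroup T] extends
    SymmetricLinkingForm T where
  ν : T → QmodZ
  map_smul : ∀ (r : ℤ) (x : T), ν (r • x) = r ^ 2 • ν x
  map_add : ∀ x y : T, ν (x + y) - ν x - ν y = b x y

/-- The isometries of a split quadratic linking form: the group automorphisms of `T` that preserve
both the linking form and its quadratic refinement. -/
def SplitQuadraticLinkingForm.Aut {T : Type*} [AddCommGroup T]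
    (L : SplitQuadraticLinkingForm T) : Subgroup (T ≃ₗ[ℤ] T) where
  carrier := {f | (∀ x y, L.b (f x) (f y) = L.b x y) ∧ ∀ x, L.ν (f x) = L.ν x}
  one_mem' := ⟨fun _ _ => rfl, fun _ => rfl⟩
  mul_mem' := fun {f g} hf hg =>
    ⟨fun x y => (hf.1 (g x) (g y)).trans (hg.1 x y), fun x => (hf.2 (g x)).trans (hg.2 x)⟩
  inv_mem' := fun {f} hf =>
    ⟨fun x y => by
      have h := hf.1 (f.symm x) (f.symm y)
      rw [f.apply_symm_apply, f.apply_symm_apply] at h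
      exact h.symm,
     fun x => by
      have h := hf.2 (f.symm x)
      rw [f.apply_symm_apply] at h
      exact h.symm⟩

/-! ### The boundary of a nondegenerate quadratic form -/

section Boundary

variable {V : Type*} [AddCommGroup V]

/-- The cokernel of the adjoint of the symmetrisation. -/
abbrev Coker (ψ : QuadraticQ V) : Type _ := Module.Dual ℤ V ⧸ LinearMap.range (adjoint ψ)

theorem finite_coker [Module.Free ℤ V] [Module.Finite ℤ V] (ψ : QuadraticQ V)
    (hψ : Nondegenerate ψ) : Finite (Coker ψ) := by
  have h1 := Submodule.finrank_quotient_add_finrank (LinearMap.range (adjoint ψ))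
  rw [LinearMap.finrank_range_of_inj hψ] at h1
  have h2 : Module.finrank ℤ (Module.Dual ℤ V) = Module.finrank ℤ V :=
    (Module.Free.chooseBasis ℤ V).toDualEquiv.finrank_eq.symm
  have h3 : Module.finrank ℤ (Coker ψ) = 0 := by
    rw [h2] at h1
    exact Nat.add_eq_right.mp h1
  have h4 : Module.IsTorsion ℤ (Coker ψ) := by
    exact Module.finrank_eq_zero_iff_isTorsion.mp h3
  exact Module.finite_of_fg_torsion _ h4

/-- Every `x : V*` has a non-zero multiple `s x` of the form `λ^ z`. -/
theorem exists_smul_eq [Module.Free ℤ V] [Module.Finite ℤ V] (ψ : QuadraticQ V)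
    (hψ : Nondegenerate ψ) (x : Module.Dual ℤ V) :
    ∃ p : ℤ × V, p.1 ≠ 0 ∧ p.1 • x = adjoint ψ p.2 := by
  have := finite_coker ψ hψ
  have h : (Nat.card (Coker ψ) : ℤ) • (Submodule.Quotient.mk x : Coker ψ) = 0 := by
    rw [natCast_zsmul]
    exact card_nsmul_eq_zero'
  rw [← Submodule.Quotient.mk_smul, Submodule.Quotient.mk_eq_zero] at h
  obtain ⟨z, hz⟩ := h
  exact ⟨(_, z), Int.natCast_ne_zero.mpr Nat.card_pos.ne', hz.symm⟩

theorem adjoint_isometry (ψ : QuadraticQ V) (h : Aut ψ) (x : V) :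
    h.1.symm.dualMap (adjoint ψ x) = adjoint ψ (h.1 x) := by
  ext y
  have hh : pullback h.1.toLinearMap ψ = ψ := h.2
  have := adjoint_pullback h.1.toLinearMap ψ x (h.1.symm y)
  rw [hh] at this
  simpa using this

theorem quadValue_isometry (ψ : QuadraticQ V) (h : Aut ψ) (x : V) :
    quadValue (h.1 x) ψ = quadValue x ψ := by
  have hh : pullback h.1.toLinearMap ψ = ψ := h.2
  have := quadValue_pullback h.1.toLinearMap ψ x
  rw [hh] at this
  exact this.symm

/-- The automorphism `[x] ↦ [(h^*)⁻¹ x]` of the cokernel induced by an isometry `h`. -/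
def cokerEquiv (ψ : QuadraticQ V) (h : Aut ψ) : Coker ψ ≃ₗ[ℤ] Coker ψ :=
  Submodule.Quotient.equiv _ _ h.1.symm.dualMap (by
    ext y
    constructor
    · rintro ⟨_, ⟨x, rfl⟩, rfl⟩
      exact ⟨h.1 x, (adjoint_isometry ψ h x).symm⟩
    · rintro ⟨x, rfl⟩
      exact ⟨_, ⟨h.1.symm x, rfl⟩, by
        have := adjoint_isometry ψ h (h.1.symm x)
        rwa [h.1.apply_symm_apply] at this⟩)

@[simp] theorem cokerEquiv_mk (ψ : QuadraticQ V) (h : Aut ψ) (x : Module.Dual ℤ V) :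
    cokerEquiv ψ h (Submodule.Quotient.mk x) =
      Submodule.Quotient.mk (h.1.symm.dualMap x) := rfl

variable [Module.Free ℤ V] [Module.Finite ℤ V] (ψ : QuadraticQ V) (hψ : Nondegenerate ψ)

/-- The integer `s` in a choice of `(s, z)` with `s x = λ^ z`, `s ≠ 0`. -/
def den (x : Module.Dual ℤ V) : ℤ := (exists_smul_eq ψ hψ x).choose.1

/-- The vector `z` in a choice of `(s, z)` with `s x = λ^ z`, `s ≠ 0`. -/
def num (x : Module.Dual ℤ V) : V := (exists_smul_eq ψ hψ x).choose.2

theorem den_ne_zero (x : Module.Dual ℤ V) : den ψ hψ x ≠ 0 :=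
  (exists_smul_eq ψ hψ x).choose_spec.1

theorem den_smul (x : Module.Dual ℤ V) : den ψ hψ x • x = adjoint ψ (num ψ hψ x) :=
  (exists_smul_eq ψ hψ x).choose_spec.2

/-- The rational number `y(z) / s`, where `s x = λ^ z`. -/
def preB (x y : Module.Dual ℤ V) : ℚ := (y (num ψ hψ x) : ℚ) / den ψ hψ x

/-- The rational number `θ(z, z) / s ^ 2`, where `s x = λ^ z`. -/
def preν (x : Module.Dual ℤ V) : ℚ := (quadValue (num ψ hψ x) ψ : ℚ) / (den ψ hψ x : ℚ) ^ 2

theorem preB_eq (x y : Module.Dual ℤ V) (s : ℤ) (z : V) (hs : s ≠ 0)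
    (h : s • x = adjoint ψ z) : preB ψ hψ x y = (y z : ℚ) / s := by
  have hd := den_ne_zero ψ hψ x
  have hz : s • num ψ hψ x = den ψ hψ x • z := by
    apply hψ
    rw [map_smul, map_smul, ← den_smul ψ hψ x, ← h, smul_comm]
  have hy : s * y (num ψ hψ x) = den ψ hψ x * y z := by
    have := congrArg y hz
    simpa using this
  have hs' : (s : ℚ) ≠ 0 := by exact_mod_cast hs
  have hd' : (den ψ hψ x : ℚ) ≠ 0 := by exact_mod_cast hd
  have hy' : (s : ℚ) * y (num ψ hψ x) = den ψ hψ x * y z := by exact_mod_cast hy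
  rw [preB, div_eq_div_iff hd' hs']
  linarith

theorem preν_eq (x : Module.Dual ℤ V) (s : ℤ) (z : V) (hs : s ≠ 0)
    (h : s • x = adjoint ψ z) : preν ψ hψ x = (quadValue z ψ : ℚ) / (s : ℚ) ^ 2 := by
  have hd := den_ne_zero ψ hψ x
  have hz : s • num ψ hψ x = den ψ hψ x • z := by
    apply hψ
    rw [map_smul, map_smul, ← den_smul ψ hψ x, ← h, smul_comm]
  have hy : s ^ 2 * quadValue (num ψ hψ x) ψ = den ψ hψ x ^ 2 * quadValue z ψ := by
    rw [← quadValue_smul, hz, quadValue_smul]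
  have hs' : (s : ℚ) ≠ 0 := by exact_mod_cast hs
  have hd' : (den ψ hψ x : ℚ) ≠ 0 := by exact_mod_cast hd
  have hy' : (s : ℚ) ^ 2 * quadValue (num ψ hψ x) ψ = (den ψ hψ x : ℚ) ^ 2 * quadValue z ψ := by
    exact_mod_cast hy
  rw [preν, div_eq_div_iff (pow_ne_zero 2 hd') (pow_ne_zero 2 hs')]
  linarith

theorem preB_comm (x y : Module.Dual ℤ V) : preB ψ hψ x y = preB ψ hψ y x := by
  have hx : (den ψ hψ x : ℚ) ≠ 0 := by exact_mod_cast den_ne_zero ψ hψ x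
  have hy : (den ψ hψ y : ℚ) ≠ 0 := by exact_mod_cast den_ne_zero ψ hψ y
  have h1 := congrArg (fun f => f (num ψ hψ y)) (den_smul ψ hψ x)
  have h2 := congrArg (fun f => f (num ψ hψ x)) (den_smul ψ hψ y)
  simp only [LinearMap.smul_apply, smul_eq_mul] at h1 h2
  rw [adjoint_comm, ← h2] at h1
  have h3 : (den ψ hψ x : ℚ) * x (num ψ hψ y) = den ψ hψ y * y (num ψ hψ x) := by
    exact_mod_cast h1
  rw [preB, preB, div_eq_div_iff hx hy]
  linarith

theorem preB_add_right (x y y' : Module.Dual ℤ V) :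
    preB ψ hψ x (y + y') = preB ψ hψ x y + preB ψ hψ x y' := by
  simp [preB, add_div]

theorem preB_add_left (x x' y : Module.Dual ℤ V) :
    preB ψ hψ (x + x') y = preB ψ hψ x y + preB ψ hψ x' y := by
  rw [preB_comm, preB_add_right, preB_comm ψ hψ y x, preB_comm ψ hψ y x']

theorem preB_adjoint_left (z : V) (y : Module.Dual ℤ V) :
    preB ψ hψ (adjoint ψ z) y = (y z : ℚ) := by
  rw [preB_eq ψ hψ _ y 1 z one_ne_zero (one_smul _ _)]
  simp

theorem preν_add (x y : Module.Dual ℤ V) :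
    preν ψ hψ (x + y) = preν ψ hψ x + preν ψ hψ y + preB ψ hψ x y := by
  have hx := den_ne_zero ψ hψ x
  have hy := den_ne_zero ψ hψ y
  have hxq : (den ψ hψ x : ℚ) ≠ 0 := by exact_mod_cast hx
  have hyq : (den ψ hψ y : ℚ) ≠ 0 := by exact_mod_cast hy
  rw [preν_eq ψ hψ (x + y) (den ψ hψ x * den ψ hψ y)
    (den ψ hψ y • num ψ hψ x + den ψ hψ x • num ψ hψ y) (mul_ne_zero hx hy) (by
      rw [map_add, map_smul, map_smul, ← den_smul, ← den_smul, smul_add, smul_smul, smul_smul,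
        mul_comm (den ψ hψ y)])]
  have h2 : den ψ hψ y * y (num ψ hψ x) = adjoint ψ (num ψ hψ x) (num ψ hψ y) := by
    have := congrArg (fun f => f (num ψ hψ x)) (den_smul ψ hψ y)
    simp only [LinearMap.smul_apply, smul_eq_mul] at this
    rw [this, adjoint_comm]
  have hq : quadValue (den ψ hψ y • num ψ hψ x + den ψ hψ x • num ψ hψ y) ψ =
      den ψ hψ y ^ 2 * quadValue (num ψ hψ x) ψ + den ψ hψ x ^ 2 * quadValue (num ψ hψ y) ψ +
        den ψ hψ y * (den ψ hψ x * (den ψ hψ y * y (num ψ hψ x))) := by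
    rw [quadValue_add, quadValue_smul, quadValue_smul, h2]
    simp only [map_smul, LinearMap.smul_apply, smul_eq_mul]
    ring
  rw [hq, preν, preν, preB]
  push_cast
  field_simp

theorem preν_smul (r : ℤ) (x : Module.Dual ℤ V) :
    preν ψ hψ (r • x) = r ^ 2 * preν ψ hψ x := by
  rw [preν_eq ψ hψ (r • x) (den ψ hψ x) (r • num ψ hψ x) (den_ne_zero ψ hψ x) (by
    rw [smul_comm, den_smul, map_smul]), quadValue_smul, preν]
  push_cast
  rw [mul_div_assoc]

theorem preν_adjoint (z : V) : preν ψ hψ (adjoint ψ z) = (quadValue z ψ : ℚ) := by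
  rw [preν_eq ψ hψ _ 1 z one_ne_zero (one_smul _ _)]
  simp

theorem intCast_QmodZ (n : ℤ) : (((n : ℚ) : QmodZ)) = 0 := by
  rw [AddCircle.coe_eq_zero_iff]
  exact ⟨n, by simp⟩

/-- The linking form `∂λ([x], [y]) = y(z) / s` on the cokernel, where `s x = λ^ z`. -/
def boundaryB : Coker ψ →+ Coker ψ →+ QmodZ :=
  QuotientAddGroup.lift _
    (AddMonoidHom.mk' (fun x => QuotientAddGroup.lift _
        (AddMonoidHom.mk' (fun y => ((preB ψ hψ x y : ℚ) : QmodZ)) (fun y y' => by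
          rw [preB_add_right, AddCircle.coe_add]))
        (by
          rintro _ ⟨z, rfl⟩
          change ((preB ψ hψ x (adjoint ψ z) : ℚ) : QmodZ) = 0
          rw [preB_comm, preB_adjoint_left, intCast_QmodZ]))
      (fun x x' => by
        refine AddMonoidHom.ext fun y => ?_
        induction y using Submodule.Quotient.induction_on with
        | H y =>
        change ((preB ψ hψ (x + x') y : ℚ) : QmodZ) = (preB ψ hψ x y : ℚ) + (preB ψ hψ x' y : ℚ)
        rw [preB_add_left, AddCircle.coe_add]))
    (by
      rintro _ ⟨z, rfl⟩
      refine AddMonoidHom.ext fun y => ?_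
      induction y using Submodule.Quotient.induction_on with
      | H y =>
      change ((preB ψ hψ (adjoint ψ z) y : ℚ) : QmodZ) = 0
      rw [preB_adjoint_left, intCast_QmodZ])

/-- The quadratic refinement `∂θ([x]) = θ(z, z) / s ^ 2` on the cokernel, where `s x = λ^ z`. -/
def boundaryν : Coker ψ → QmodZ :=
  Quotient.lift (fun x => ((preν ψ hψ x : ℚ) : QmodZ)) (by
    intro x x' h
    obtain ⟨z, hz⟩ := (Submodule.quotientRel_def _).mp h
    rw [sub_eq_iff_eq_add.mp hz.symm, preν_add, preν_adjoint, preB_adjoint_left,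
      AddCircle.coe_add, AddCircle.coe_add, intCast_QmodZ, intCast_QmodZ, zero_add, add_zero])

theorem boundaryB_mk (x y : Module.Dual ℤ V) (s : ℤ) (z : V) (hs : s ≠ 0)
    (h : s • x = adjoint ψ z) :
    boundaryB ψ hψ (Submodule.Quotient.mk x) (Submodule.Quotient.mk y) =
      (((y z : ℚ) / s : ℚ) : QmodZ) := by
  rw [← preB_eq ψ hψ x y s z hs h]
  rfl

theorem boundaryν_mk (x : Module.Dual ℤ V) (s : ℤ) (z : V) (hs : s ≠ 0)
    (h : s • x = adjoint ψ z) :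
    boundaryν ψ hψ (Submodule.Quotient.mk x) =
      (((quadValue z ψ : ℚ) / (s : ℚ) ^ 2 : ℚ) : QmodZ) := by
  rw [← preν_eq ψ hψ x s z hs h]
  rfl

/-- The boundary split quadratic linking form `∂(V, ψ)` of a nondegenerate quadratic form. -/
def boundary : SplitQuadraticLinkingForm (Coker ψ) where
  finite := finite_coker ψ hψ
  b := boundaryB ψ hψ
  symm := by
    intro x y
    induction x using Submodule.Quotient.induction_on with
    | H x =>
    induction y using Submodule.Quotient.induction_on with
    | H y => exact congrArg (fun q : ℚ => (q : QmodZ)) (preB_comm ψ hψ x y)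
  ν := boundaryν ψ hψ
  map_smul := by
    intro r x
    induction x using Submodule.Quotient.induction_on with
    | H x =>
    change ((preν ψ hψ (r • x) : ℚ) : QmodZ) = r ^ 2 • ((preν ψ hψ x : ℚ) : QmodZ)
    rw [preν_smul, ← AddCircle.coe_zsmul]
    simp
  map_add := by
    intro x y
    induction x using Submodule.Quotient.induction_on with
    | H x =>
    induction y using Submodule.Quotient.induction_on with
    | H y =>
    change ((preν ψ hψ (x + y) : ℚ) : QmodZ) - (preν ψ hψ x : ℚ) - (preν ψ hψ y : ℚ) =
      (preB ψ hψ x y : ℚ)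
    rw [preν_add, AddCircle.coe_add, AddCircle.coe_add]
    abel

/-- The boundary homomorphism `∂ : Aut(V, ψ) → Aut(∂(V, ψ))`, `∂h = (h^*)⁻¹`. -/
def boundaryMap : Aut ψ →* (boundary ψ hψ).Aut where
  toFun h := ⟨cokerEquiv ψ h, by
    have key (x : Module.Dual ℤ V) :
        den ψ hψ x • h.1.symm.dualMap x = adjoint ψ (h.1 (num ψ hψ x)) := by
      rw [← adjoint_isometry, ← den_smul, map_smul]
    refine ⟨fun x y => ?_, fun x => ?_⟩
    · induction x using Submodule.Quotient.induction_on with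
      | H x =>
      induction y using Submodule.Quotient.induction_on with
      | H y =>
      change ((preB ψ hψ (h.1.symm.dualMap x) (h.1.symm.dualMap y) : ℚ) : QmodZ) =
        (preB ψ hψ x y : ℚ)
      rw [preB_eq ψ hψ _ _ _ _ (den_ne_zero ψ hψ x) (key x), preB]
      simp
    · induction x using Submodule.Quotient.induction_on with
      | H x =>
      change ((preν ψ hψ (h.1.symm.dualMap x) : ℚ) : QmodZ) = (preν ψ hψ x : ℚ)
      rw [preν_eq ψ hψ _ _ _ (den_ne_zero ψ hψ x) (key x), quadValue_isometry, preν]⟩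
  map_one' := by
    ext x
    induction x using Submodule.Quotient.induction_on with
    | H x => rfl
  map_mul' g h := by
    ext x
    induction x using Submodule.Quotient.induction_on with
    | H x => rfl

/-- The action of `Aut(V, ψ) × Aut(V, ψ)` on `Aut(∂(V, ψ))` by `(h, g) • f = ∂h ∘ f ∘ (∂g)⁻¹`. -/
@[reducible] def boundaryAction : MulAction (Aut ψ × Aut ψ) (boundary ψ hψ).Aut where
  smul p f := boundaryMap ψ hψ p.1 * f * (boundaryMap ψ hψ p.2)⁻¹
  one_smul f := by
    change boundaryMap ψ hψ 1 * f * (boundaryMap ψ hψ 1)⁻¹ = f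
    simp
  mul_smul p q f := by
    change boundaryMap ψ hψ (p.1 * q.1) * f * (boundaryMap ψ hψ (p.2 * q.2))⁻¹ =
      boundaryMap ψ hψ p.1 * (boundaryMap ψ hψ q.1 * f * (boundaryMap ψ hψ q.2)⁻¹) *
        (boundaryMap ψ hψ p.2)⁻¹
    simp [mul_assoc]

/-- The boundary automorphism set `bAut(V, ψ)`, the set of orbits of
`Aut(V, ψ) × Aut(V, ψ)` on `Aut(∂(V, ψ))`. -/
def BAut : Type _ :=
  Quotient (@MulAction.orbitRel (Aut ψ × Aut ψ) (boundary ψ hψ).Aut _ (boundaryAction ψ hψ))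

end Boundary

/-! ### The forms `(ℤ^h, ± [[4, 4, …, 4], [0, 2, …, 2], …, [0, …, 0, 2]])` -/

/-- The upper triangular `h × h` matrix with first row `(4, …, 4)` and all the other entries on or
above the diagonal equal to `2`. -/
def formMatrix (h : ℕ) : Matrix (Fin h) (Fin h) ℤ :=
  Matrix.of fun i j => if i ≤ j then (if (i : ℕ) = 0 then 4 else 2) else 0

/-- The class in `Q_+(ℤ^h)` of the form `(x, y) ↦ ε xᵀ Q y`, with `Q` the above matrix and
`ε` a sign. -/
def form (h : ℕ) (ε : ℤˣ) : QuadraticQ (Fin h → ℤ) :=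
  QuadraticQ.mk (Matrix.toBilin' ((ε : ℤ) • formMatrix h))

theorem formMatrix_add (h : ℕ) (i j : Fin h) :
    formMatrix h i j + formMatrix h j i =
      (if (i : ℕ) = 0 ∨ (j : ℕ) = 0 then 4 else 2) * (if i = j then 2 else 1) := by
  simp only [formMatrix, Matrix.of_apply, Fin.le_def, Fin.ext_iff]
  split_ifs <;> omega

theorem adjoint_form_single (h : ℕ) (ε : ℤˣ) (x : Fin h → ℤ) (j : Fin h) :
    adjoint (form h ε) x (Pi.single j 1) =
      ε * ∑ i, x i * (formMatrix h i j + formMatrix h j i) := by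
  change Matrix.toBilin' _ x (Pi.single j 1) + Matrix.toBilin' _ (Pi.single j 1) x = _
  simp only [Matrix.toBilin'_apply, Pi.single_apply, Matrix.smul_apply, smul_eq_mul, mul_ite,
    mul_one, mul_zero, ite_mul, one_mul, zero_mul, Finset.sum_ite_eq', Finset.mem_univ, if_true,
    Finset.sum_ite_irrel, Finset.sum_const_zero]
  rw [← Finset.sum_add_distrib, Finset.mul_sum]
  exact Finset.sum_congr rfl fun i _ => by ring

theorem form_nondegenerate (h : ℕ) (ε : ℤˣ) : Nondegenerate (form h ε) := by
  rw [Nondegenerate, injective_iff_map_eq_zero]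
  intro x hx
  have row (j : Fin h) : ∑ i, x i * (formMatrix h i j + formMatrix h j i) = 0 := by
    have h1 := adjoint_form_single h ε x j
    rw [hx, LinearMap.zero_apply] at h1
    exact (mul_eq_zero.mp h1.symm).resolve_left ε.ne_zero
  rcases h with _ | n
  · exact Subsingleton.elim _ _
  have hne (j : Fin (n + 1)) (hj : j ≠ 0) : x j = 0 := by
    have hj' : (j : ℕ) ≠ 0 := fun h => hj (Fin.ext h)
    have e : ∑ i, x i * (2 * (formMatrix (n + 1) i j + formMatrix (n + 1) j i) -
        (formMatrix (n + 1) i 0 + formMatrix (n + 1) 0 i)) = 0 := by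
      simp only [mul_sub, Finset.sum_sub_distrib, mul_left_comm _ (2 : ℤ), ← Finset.mul_sum, row]
      simp
    rw [Finset.sum_eq_single j] at e
    · simp only [formMatrix_add] at e
      simp [hj, hj'] at e
      exact e
    · intro i _ hij
      simp only [formMatrix_add]
      by_cases hi : i = 0
      · subst hi
        simp [hij]
      · have hi' : (i : ℕ) ≠ 0 := fun h => hi (Fin.ext h)
        simp [hij, hi, hi', hj']
    · simp
  ext j
  by_cases hj : j = 0
  · subst hj
    have e := row 0
    rw [Finset.sum_eq_single 0] at e
    · simp only [formMatrix_add] at e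
      simpa using e
    · intro i _ hi
      simp [hne i hi]
    · simp
  · exact hne j hj

end BoundaryForms

end

noncomputable section

namespace BoundaryForms

open scoped Pointwise

/-! ### Quadratic forms on `ℤ^n` are determined by their values -/

/-! In Euclidean coordinates (`euclid`) the form is `ε` times the norm on the lattice `D_h` of
integral vectors with even coordinate sum, with bilinear form `2ε⟨x, y⟩`. Its boundary is therefore
`D_h^*/2D_h` with quadratic function `ε|v|²/4` and linking form `ε⟨v, w⟩/2` modulo 1. Here `D_h^*`
is the union of `ℤ^h` and `ℤ^h + (1/2, …, 1/2)`.

The key object is the unit frame, the set of classes of the vectors `±e_i`. For `h ≥ 5` the `±e_i`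
are exactly the vectors of norm 1 in `D_h^*`, so every isometry of the lattice permutes them.
Conversely, an automorphism of the boundary that preserves the frame acts on it by a signed
permutation, which lifts to the lattice, and it is determined by this action. So the image of `∂` is
the stabiliser of the unit frame (`stabilizer_unitFrame`), and its index is the size of the orbit of
the frame.

The orbit is computed combinatorially. If `h` is not 4 modulo 8, an automorphism sends each `e_i` to
the class of an integral vector whose set of odd coordinates has size 1 modulo 4, and these sets
meet pairwise in an even number of elements (`exists_oddSupp_of_aut`). For `h = 6` the sets are all
singletons or all complements of singletons, which gives two frames. For `h = 7` the sets of size 1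
or 5 correspond to the edges of the complete graph on 8 vertices, with even intersection meaning
that two edges share exactly one vertex. Seven such edges form a star, which gives eight frames, one
per vertex. Every frame is attained, by the identity or by a transvection along a class with
quadratic value `1/2` (`exists_smul_unitFrame_eq`).

Finally, `bAut` is the set of double cosets of the image of `∂`, so it is non-trivial as soon as `∂`
is not surjective. -/

theorem QuadraticQ.ext_quadValue {n : ℕ} {ψ ψ' : QuadraticQ (Fin n → ℤ)}
    (h : ∀ x, quadValue x ψ = quadValue x ψ') : ψ = ψ' := by
  obtain ⟨φ, hφ⟩ := Submodule.Quotient.mk_surjective _ (ψ - ψ')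
  have alt (x : Fin n → ℤ) : φ x x = 0 := by
    have e : quadValue x (ψ - ψ') = 0 := by rw [map_sub, h, sub_self]
    rwa [← hφ] at e
  have skew (x y : Fin n → ℤ) : φ y x = - φ x y := by
    have e := alt (x + y)
    simp only [map_add, LinearMap.add_apply, alt] at e
    linarith
  rw [← sub_eq_zero, ← hφ, Submodule.Quotient.mk_eq_zero]
  -- An alternating form equals `A - Aᵀ`, where `A` is its strictly upper triangular part.
  refine ⟨Matrix.toBilin' (Matrix.of fun i j =>
    if i < j then φ (Pi.single i 1) (Pi.single j 1) else 0), ?_⟩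
  refine LinearMap.pi_ext' fun i => LinearMap.ext_ring ?_
  refine LinearMap.pi_ext' fun j => LinearMap.ext_ring ?_
  change Matrix.toBilin' _ (Pi.single i 1) (Pi.single j 1) -
    Matrix.toBilin' _ (Pi.single j 1) (Pi.single i 1) = φ (Pi.single i 1) (Pi.single j 1)
  rw [Matrix.toBilin'_single, Matrix.toBilin'_single]
  rcases lt_trichotomy i j with hij | rfl | hij
  · simp [hij, hij.not_gt]
  · simp [alt]
  · simp [hij, hij.not_gt, skew (Pi.single i 1) (Pi.single j 1)]

/-! ### The lattice `D_h` and its dual -/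

variable {n : ℕ}

/-- The embedding of `ℤ^h` onto the sublattice `D_h` of vectors with even coordinate sum. -/
def euclid (n : ℕ) : (Fin (n + 1) → ℤ) →ₗ[ℤ] (Fin (n + 1) → ℤ) where
  toFun x := Fin.cons (2 * x 0 + ∑ j : Fin n, x j.succ) (fun j => x j.succ)
  map_add' x y := by
    ext i
    refine Fin.cases ?_ (fun j => ?_) i
    · simp [Finset.sum_add_distrib]; ring
    · simp
  map_smul' r x := by
    ext i
    refine Fin.cases ?_ (fun j => ?_) i
    · simp [← Finset.mul_sum]; ring
    · simp

@[simp] theorem euclid_zero (x : Fin (n + 1) → ℤ) :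
    euclid n x 0 = 2 * x 0 + ∑ j : Fin n, x j.succ := rfl

@[simp] theorem euclid_succ (x : Fin (n + 1) → ℤ) (j : Fin n) :
    euclid n x j.succ = x j.succ := rfl

theorem euclid_injective : Function.Injective (euclid n) := by
  rw [injective_iff_map_eq_zero]
  intro x hx
  have hs (j : Fin n) : x j.succ = 0 := by simpa using congrFun hx j.succ
  have h0 := congrFun hx 0
  ext i
  refine Fin.cases ?_ (fun j => ?_) i
  · simpa [hs] using h0
  · exact hs j

theorem mem_range_euclid (v : Fin (n + 1) → ℤ) :
    v ∈ LinearMap.range (euclid n) ↔ Even (∑ i, v i) := by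
  rw [Fin.sum_univ_succ]
  constructor
  · rintro ⟨x, rfl⟩
    simp only [euclid_zero, euclid_succ]
    exact ⟨x 0 + ∑ j : Fin n, x j.succ, by ring⟩
  · rintro ⟨k, hk⟩
    refine ⟨Fin.cons (k - ∑ j : Fin n, v j.succ) fun j => v j.succ, ?_⟩
    ext i
    refine Fin.cases ?_ (fun j => ?_) i
    · simp; linarith
    · simp

/-- Twice the coordinates, with respect to the standard basis of the Euclidean space containing
`D_h`, of the element of the dual lattice given by a functional. -/
def coords (n : ℕ) : Module.Dual ℤ (Fin (n + 1) → ℤ) →ₗ[ℤ] (Fin (n + 1) → ℤ) where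
  toFun φ := Fin.cons (φ (Pi.single 0 1))
    (fun j => 2 * φ (Pi.single j.succ 1) - φ (Pi.single 0 1))
  map_add' x y := by
    ext i
    refine Fin.cases ?_ (fun j => ?_) i
    · simp
    · simp; ring
  map_smul' r x := by
    ext i
    refine Fin.cases ?_ (fun j => ?_) i
    · simp
    · simp; ring

theorem coords_zero (φ : Module.Dual ℤ (Fin (n + 1) → ℤ)) :
    coords n φ 0 = φ (Pi.single 0 1) := rfl

theorem coords_succ (φ : Module.Dual ℤ (Fin (n + 1) → ℤ)) (j : Fin n) :
    coords n φ j.succ = 2 * φ (Pi.single j.succ 1) - φ (Pi.single 0 1) := rfl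

/-- The factor 2 compensates for the doubling in `coords`: the functional is the scalar product with
`coords n φ / 2`. -/
theorem two_mul_dual_apply (φ : Module.Dual ℤ (Fin (n + 1) → ℤ)) (x : Fin (n + 1) → ℤ) :
    2 * φ x = ∑ i, coords n φ i * euclid n x i := by
  have h1 : φ x = ∑ i, x i * φ (Pi.single i 1) := by
    conv_lhs => rw [pi_eq_sum_univ' x, map_sum]
    simp only [map_smul, smul_eq_mul]
  rw [h1, Fin.sum_univ_succ, Fin.sum_univ_succ]
  simp only [coords_zero, coords_succ, euclid_zero, euclid_succ, mul_add, Finset.mul_sum]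
  rw [add_assoc, ← Finset.sum_add_distrib]
  congr 1
  · ring
  · exact Finset.sum_congr rfl fun j _ => by ring

theorem coords_injective : Function.Injective (coords n) := by
  rw [injective_iff_map_eq_zero]
  intro φ hφ
  ext1 x
  have h := two_mul_dual_apply φ (Pi.single x 1)
  rw [hφ] at h
  refine LinearMap.ext_ring ?_
  simpa using h

theorem coords_parity (φ : Module.Dual ℤ (Fin (n + 1) → ℤ)) (i : Fin (n + 1)) :
    Even (coords n φ i - coords n φ 0) := by
  refine Fin.cases (by simp) (fun j => ?_) i
  rw [coords_succ, coords_zero]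
  exact ⟨φ (Pi.single j.succ 1) - φ (Pi.single 0 1), by ring⟩

/-- The functional on `ℤ^h ≅ D_h` given by the scalar product with an integral vector. -/
def pairing (n : ℕ) : (Fin (n + 1) → ℤ) →ₗ[ℤ] Module.Dual ℤ (Fin (n + 1) → ℤ) :=
  LinearMap.mk₂ ℤ (fun u x => ∑ i, u i * euclid n x i)
    (fun u u' x => by simp [add_mul, Finset.sum_add_distrib])
    (fun r u x => by simp [mul_assoc, Finset.mul_sum])
    (fun u x x' => by simp only [map_add, Pi.add_apply, mul_add, Finset.sum_add_distrib])
    (fun r u x => by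
      simp only [map_smul, Pi.smul_apply, smul_eq_mul, Finset.mul_sum, mul_left_comm])

theorem pairing_apply (u x : Fin (n + 1) → ℤ) :
    pairing n u x = ∑ i, u i * euclid n x i := rfl

theorem euclid_single_zero : euclid n (Pi.single 0 1) = Pi.single 0 2 := by
  ext i
  refine Fin.cases ?_ (fun j => ?_) i <;> simp

theorem euclid_single_succ (j : Fin n) :
    euclid n (Pi.single j.succ 1) = Pi.single 0 1 + Pi.single j.succ 1 := by
  ext i
  refine Fin.cases ?_ (fun j => ?_) i <;> simp [Pi.single_apply]

@[simp] theorem coords_pairing (u : Fin (n + 1) → ℤ) : coords n (pairing n u) = 2 • u := by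
  ext i
  refine Fin.cases ?_ (fun j => ?_) i
  · rw [coords_zero, pairing_apply, euclid_single_zero]
    simp [Pi.single_apply, mul_comm]
  · rw [coords_succ, pairing_apply, pairing_apply, euclid_single_zero, euclid_single_succ]
    simp only [Pi.add_apply, mul_add, Finset.sum_add_distrib]
    simp [Pi.single_apply]
    ring

/-- The functional given by the scalar product with `(1/2, …, 1/2)`. -/
def spin (n : ℕ) : Module.Dual ℤ (Fin (n + 1) → ℤ) := ∑ i, LinearMap.proj i

theorem coords_spin : coords n (spin n) = 1 := by
  ext i
  refine Fin.cases ?_ (fun j => ?_) i <;> simp [coords_zero, coords_succ, spin]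

/-- The doubled coordinates of a dual vector all have the same parity. Even ones give an integral
vector, odd ones a vector in the coset of `(1/2, …, 1/2)`. -/
theorem eq_pairing_or_eq_pairing_add_spin (φ : Module.Dual ℤ (Fin (n + 1) → ℤ)) :
    ∃ u, φ = pairing n u ∨ φ = pairing n u + spin n := by
  choose k hk using coords_parity φ
  rcases Int.even_or_odd' (coords n φ 0) with ⟨c, hc | hc⟩
  · refine ⟨fun i => k i + c, Or.inl (coords_injective ?_)⟩
    ext i
    have := hk i
    simp
    linarith
  · refine ⟨fun i => k i + c, Or.inr (coords_injective ?_)⟩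
    ext i
    have := hk i
    simp [coords_spin]
    linarith

/-! ### The forms in Euclidean coordinates -/

variable (ε : ℤˣ)

theorem units_mul_self (ε : ℤˣ) : (ε : ℤ) * ε = 1 := by
  rw [← Units.val_mul, Int.units_mul_self, Units.val_one]

/-- The bilinear form is `2ε` times the Euclidean one; the other factor 2 comes from the doubling in
`coords`. -/
theorem coords_adjoint (z : Fin (n + 1) → ℤ) :
    coords n (adjoint (form (n + 1) ε) z) = (4 * ε : ℤ) • euclid n z := by
  ext i
  refine Fin.cases ?_ (fun j => ?_) i
  · rw [coords_zero, adjoint_form_single]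
    simp only [formMatrix_add, Fin.sum_univ_succ]
    simp [Fin.succ_ne_zero, ← Finset.sum_mul]
    ring
  · rw [coords_succ, adjoint_form_single, adjoint_form_single]
    simp only [formMatrix_add, Fin.sum_univ_succ]
    have hs : (∑ i : Fin n, if i = j then z i.succ * 4 else z i.succ * 2) =
        (∑ i : Fin n, z i.succ) * 2 + z j.succ * 2 := by
      rw [Finset.sum_mul, ← Finset.sum_ite_eq_of_mem' Finset.univ j (fun i => z i.succ * 2)
        (Finset.mem_univ j), ← Finset.sum_add_distrib]
      exact Finset.sum_congr rfl fun i _ => by split_ifs <;> ring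
    simp [Fin.succ_ne_zero, ← Finset.sum_mul, (Fin.succ_ne_zero _).symm]
    rw [hs]
    ring

theorem adjoint_form (x y : Fin (n + 1) → ℤ) :
    adjoint (form (n + 1) ε) x y = 2 * ε * ∑ i, euclid n x i * euclid n y i := by
  have h := two_mul_dual_apply (adjoint (form (n + 1) ε) x) y
  rw [coords_adjoint] at h
  simp only [Pi.smul_apply, smul_eq_mul, mul_assoc, ← Finset.mul_sum] at h
  linarith

theorem quadValue_form (x : Fin (n + 1) → ℤ) :
    quadValue x (form (n + 1) ε) = ε * ∑ i, euclid n x i ^ 2 := by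
  have h1 := quadValue_add (form (n + 1) ε) x x
  rw [← two_smul ℤ x, quadValue_smul, adjoint_form] at h1
  simp only [← sq] at h1
  linarith

/-- The sublattice divided out is `2D_h`, which in doubled coordinates is `4D_h`. -/
theorem mem_range_adjoint_form {φ : Module.Dual ℤ (Fin (n + 1) → ℤ)} :
    φ ∈ LinearMap.range (adjoint (form (n + 1) ε)) ↔
      ∃ v : Fin (n + 1) → ℤ, coords n φ = (4 : ℤ) • v ∧ Even (∑ i, v i) := by
  constructor
  · rintro ⟨z, rfl⟩
    refine ⟨(ε : ℤ) • euclid n z, by rw [coords_adjoint, smul_smul], ?_⟩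
    exact (mem_range_euclid _).1 ((LinearMap.range (euclid n)).smul_mem _ ⟨z, rfl⟩)
  · rintro ⟨v, hv, he⟩
    obtain ⟨z, hz⟩ := (LinearMap.range (euclid n)).smul_mem (ε : ℤ) ((mem_range_euclid v).2 he)
    refine ⟨z, coords_injective ?_⟩
    rw [coords_adjoint, hz, hv, smul_smul, mul_assoc, units_mul_self, mul_one]

theorem exists_eight_smul (φ : Module.Dual ℤ (Fin (n + 1) → ℤ)) :
    ∃ z, (8 : ℤ) • φ = adjoint (form (n + 1) ε) z ∧ euclid n z = (2 * ε : ℤ) • coords n φ := by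
  -- The multiplier 8 is chosen so that `8 • coords n φ = 4ε • (2ε • coords n φ)`, where the last
  -- vector has even entries and so lies in `D_h`.
  obtain ⟨z, hz⟩ := (mem_range_euclid ((2 * ε : ℤ) • coords n φ)).2 (by
    simp only [Pi.smul_apply, smul_eq_mul, mul_assoc, ← Finset.mul_sum]
    exact even_two_mul _)
  refine ⟨z, coords_injective ?_, hz⟩
  rw [coords_adjoint, hz, smul_smul, map_smul]
  congr 1
  linear_combination -8 * units_mul_self ε

theorem preν_form (φ : Module.Dual ℤ (Fin (n + 1) → ℤ)) :
    preν _ (form_nondegenerate (n + 1) ε) φ =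
      ((ε * ∑ i, coords n φ i ^ 2 : ℤ) : ℚ) / 16 := by
  obtain ⟨z, hz, hv⟩ := exists_eight_smul ε φ
  rw [preν_eq _ _ φ 8 z (by norm_num) hz, quadValue_form, hv]
  have : (ε : ℤ) * ∑ i, ((2 * ε : ℤ) • coords n φ) i ^ 2 =
      4 * (ε * ∑ i, coords n φ i ^ 2) := by
    simp only [Pi.smul_apply, smul_eq_mul, mul_pow, ← Finset.mul_sum]
    linear_combination 4 * ε * (∑ i, coords n φ i ^ 2) * units_mul_self ε
  rw [this]
  push_cast
  ring

theorem preB_form (φ φ' : Module.Dual ℤ (Fin (n + 1) → ℤ)) :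
    preB _ (form_nondegenerate (n + 1) ε) φ φ' =
      ((ε * ∑ i, coords n φ i * coords n φ' i : ℤ) : ℚ) / 8 := by
  obtain ⟨z, hz, hv⟩ := exists_eight_smul ε φ
  rw [preB_eq _ _ φ φ' 8 z (by norm_num) hz]
  have h := two_mul_dual_apply φ' z
  rw [hv] at h
  have : φ' z = ε * ∑ i, coords n φ i * coords n φ' i := by
    simp only [Pi.smul_apply, smul_eq_mul, mul_left_comm _ (2 * (ε : ℤ)), ← Finset.mul_sum] at h
    simp only [mul_comm (coords n φ _)]
    linarith
  rw [this]
  norm_num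

theorem coe_div_eq_zero_iff {k : ℤ} (hk : k ≠ 0) (a : ℤ) :
    (((a : ℚ) / k : ℚ) : QmodZ) = 0 ↔ k ∣ a := by
  have hk' : (k : ℚ) ≠ 0 := by exact_mod_cast hk
  rw [AddCircle.coe_eq_zero_iff]
  simp only [zsmul_eq_mul, mul_one, eq_div_iff hk']
  constructor
  · rintro ⟨c, hc⟩
    exact ⟨c, by rw [mul_comm]; exact_mod_cast hc.symm⟩
  · rintro ⟨c, rfl⟩
    exact ⟨c, by push_cast; ring⟩

theorem coe_div_eq_coe_div_iff {k : ℤ} (hk : k ≠ 0) (a b : ℤ) :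
    (((a : ℚ) / k : ℚ) : QmodZ) = (((b : ℚ) / k : ℚ) : QmodZ) ↔ k ∣ a - b := by
  rw [← sub_eq_zero, ← AddCircle.coe_sub, ← sub_div, ← coe_div_eq_zero_iff hk, Int.cast_sub]

/-! ### The odd support of an integral vector -/

/-- The set of indices of the odd coordinates. -/
def oddSupp {ι : Type*} [Fintype ι] (u : ι → ℤ) : Finset ι := {i | Odd (u i)}

section OddSupp

variable {ι : Type*} [Fintype ι]

theorem mem_oddSupp {u : ι → ℤ} {i : ι} : i ∈ oddSupp u ↔ Odd (u i) := by simp [oddSupp]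

theorem oddSupp_neg (u : ι → ℤ) : oddSupp (-u) = oddSupp u := by
  ext i
  simp [mem_oddSupp]

theorem oddSupp_add [DecidableEq ι] (u v : ι → ℤ) :
    oddSupp (u + v) = symmDiff (oddSupp u) (oddSupp v) := by
  ext i
  simp only [mem_oddSupp, Finset.mem_symmDiff, Pi.add_apply, Int.odd_add, ← Int.not_odd_iff_even]
  tauto

theorem oddSupp_indicator [DecidableEq ι] (K : Finset ι) :
    oddSupp (fun i => if i ∈ K then (1 : ℤ) else 0) = K := by
  ext i
  by_cases h : i ∈ K <;> simp [mem_oddSupp, h]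

theorem oddSupp_single [DecidableEq ι] (i : ι) : oddSupp (Pi.single i (1 : ℤ)) = {i} := by
  ext j
  by_cases h : j = i
  · subst h; simp [mem_oddSupp]
  · simp [mem_oddSupp, h]

theorem four_dvd_sum_sq_sub_card_oddSupp (u : ι → ℤ) :
    4 ∣ ∑ i, u i ^ 2 - ((oddSupp u).card : ℤ) := by
  rw [oddSupp, Finset.card_filter, Nat.cast_sum, ← Finset.sum_sub_distrib]
  refine Finset.dvd_sum fun i _ => ?_
  rcases Int.even_or_odd' (u i) with ⟨c, hc | hc⟩
  · rw [hc]
    exact ⟨c ^ 2, by simp [← Int.not_even_iff_odd]; ring⟩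
  · rw [hc]
    exact ⟨c ^ 2 + c, by simp; ring⟩

theorem even_sum_mul_iff [DecidableEq ι] (u v : ι → ℤ) :
    Even (∑ i, u i * v i) ↔ Even (oddSupp u ∩ oddSupp v).card := by
  have h : 2 ∣ ∑ i, u i * v i - ((oddSupp u ∩ oddSupp v).card : ℤ) := by
    rw [oddSupp, oddSupp, ← Finset.filter_and, Finset.card_filter, Nat.cast_sum,
      ← Finset.sum_sub_distrib]
    refine Finset.dvd_sum fun i _ => ?_
    rcases Int.even_or_odd' (u i) with ⟨c, hc | hc⟩ <;>
      rcases Int.even_or_odd' (v i) with ⟨d, hd | hd⟩ <;> rw [hc, hd]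
    · exact ⟨c * d * 2, by simp [← Int.not_even_iff_odd]; ring⟩
    · exact ⟨c * (2 * d + 1), by simp [← Int.not_even_iff_odd]; ring⟩
    · exact ⟨d * (2 * c + 1), by simp [← Int.not_even_iff_odd]; ring⟩
    · exact ⟨2 * c * d + c + d, by simp; ring⟩
  rw [← even_iff_two_dvd, Int.even_sub, Int.even_coe_nat] at h
  exact h

theorem card_oddSupp_le_sum_sq (u : ι → ℤ) : ((oddSupp u).card : ℤ) ≤ ∑ i, u i ^ 2 := by
  rw [oddSupp, Finset.card_filter, Nat.cast_sum]
  refine Finset.sum_le_sum fun i _ => ?_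
  split_ifs with h
  · have : u i ≠ 0 := by rintro h0; simp [h0] at h
    have := sq_pos_of_ne_zero this
    push_cast
    linarith
  · simpa using sq_nonneg (u i)

/-- Odd squares are 1 modulo 8. This controls the norms in the coset of `(1/2, …, 1/2)`. -/
theorem eight_dvd_sum_sq_sub_card (u : ι → ℤ) :
    8 ∣ ∑ i, (2 * u i + 1) ^ 2 - (Fintype.card ι : ℤ) := by
  have : (Fintype.card ι : ℤ) = ∑ _i : ι, 1 := by simp
  rw [this, ← Finset.sum_sub_distrib]
  refine Finset.dvd_sum fun i _ => ?_
  obtain ⟨k, hk⟩ := Int.even_mul_succ_self (u i)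
  exact ⟨k, by linear_combination 4 * hk⟩

end OddSupp

/-! ### The discriminant group -/

/-- The class in the cokernel of an integral vector, considered as an element of the dual
lattice of `D_h`. -/
def intClass : (Fin (n + 1) → ℤ) →ₗ[ℤ] Coker (form (n + 1) ε) :=
  Submodule.mkQ _ ∘ₗ pairing n

theorem intClass_apply (u : Fin (n + 1) → ℤ) :
    intClass ε u = Submodule.Quotient.mk (pairing n u) := rfl

/-- The class in the cokernel of `(1/2, …, 1/2)`. -/
def spinClass (n : ℕ) (ε : ℤˣ) : Coker (form (n + 1) ε) := Submodule.Quotient.mk (spin n)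

theorem exists_eq_intClass (x : Coker (form (n + 1) ε)) :
    ∃ u, x = intClass ε u ∨ x = intClass ε u + spinClass n ε := by
  induction x using Submodule.Quotient.induction_on with
  | H φ =>
  obtain ⟨u, rfl | rfl⟩ := eq_pairing_or_eq_pairing_add_spin φ
  · exact ⟨u, Or.inl rfl⟩
  · exact ⟨u, Or.inr rfl⟩

theorem intClass_eq_zero_iff (u : Fin (n + 1) → ℤ) :
    intClass ε u = 0 ↔ ∃ v : Fin (n + 1) → ℤ, u = (2 : ℤ) • v ∧ Even (∑ i, v i) := by
  rw [intClass_apply, Submodule.Quotient.mk_eq_zero, mem_range_adjoint_form, coords_pairing]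
  refine exists_congr fun v => and_congr_left fun _ => ?_
  constructor
  · intro h
    ext i
    have := congrFun h i
    simp at this
    simp
    linarith
  · rintro rfl
    ext i
    simp
    ring

theorem oddSupp_eq_of_intClass_eq {u v : Fin (n + 1) → ℤ} (h : intClass ε u = intClass ε v) :
    oddSupp u = oddSupp v := by
  rw [← sub_eq_zero, ← map_sub, intClass_eq_zero_iff] at h
  obtain ⟨w, hw, -⟩ := h
  ext i
  have : u i = v i + 2 * w i := by
    have := congrFun hw i
    simp at this
    linarith
  rw [mem_oddSupp, mem_oddSupp, this, Int.odd_add]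
  simp

theorem intClass_eq_of_card_oddSupp_eq_one {u : Fin (n + 1) → ℤ} (h : (oddSupp u).card = 1) :
    ∃ (i : Fin (n + 1)) (σ : ℤˣ), intClass ε u = intClass ε (Pi.single i (σ : ℤ)) := by
  obtain ⟨i, hi⟩ := Finset.card_eq_one.1 h
  have hu (j : Fin (n + 1)) : ∃ k, u j = Pi.single (M := fun _ => ℤ) i 1 j + 2 * k := by
    have hj : j ∈ oddSupp u ↔ j = i := by simp [hi]
    rw [mem_oddSupp] at hj
    by_cases hji : j = i
    · obtain ⟨k, hk⟩ := hj.2 hji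
      exact ⟨k, by subst hji; simp [hk]; ring⟩
    · obtain ⟨k, hk⟩ := Int.not_odd_iff_even.1 (mt hj.1 hji)
      exact ⟨k, by simp [hk, hji]; ring⟩
  choose k hk using hu
  rcases Int.even_or_odd (∑ j, k j) with he | ho
  · refine ⟨i, 1, ?_⟩
    rw [← sub_eq_zero, ← map_sub, intClass_eq_zero_iff]
    exact ⟨k, by ext j; simp [hk j], he⟩
  -- If `k` is not in `D_h`, then `k + e_i` is, and `e_i + 2k = -e_i + 2(k + e_i)`.
  · refine ⟨i, -1, ?_⟩
    rw [← sub_eq_zero, ← map_sub, intClass_eq_zero_iff]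
    refine ⟨k + Pi.single i 1, ?_, ?_⟩
    · ext j
      by_cases hji : j = i
      · subst hji; simp [hk j]; ring
      · simp [hk j, hji]
    · simp only [Pi.add_apply, Finset.sum_add_distrib, Finset.sum_pi_single', Finset.mem_univ,
        if_true]
      exact ho.add_odd odd_one

/-! ### The linking form in coordinates -/

theorem boundaryν_eq_iff (φ φ' : Module.Dual ℤ (Fin (n + 1) → ℤ)) :
    (boundary _ (form_nondegenerate (n + 1) ε)).ν (Submodule.Quotient.mk φ) =
      (boundary _ (form_nondegenerate (n + 1) ε)).ν (Submodule.Quotient.mk φ') ↔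
    16 ∣ ∑ i, coords n φ i ^ 2 - ∑ i, coords n φ' i ^ 2 := by
  change ((preν _ (form_nondegenerate (n + 1) ε) φ : ℚ) : QmodZ) =
    (preν _ (form_nondegenerate (n + 1) ε) φ' : ℚ) ↔ _
  rw [preν_form, preν_form]
  refine (coe_div_eq_coe_div_iff (k := 16) (by norm_num) _ _).trans ?_
  rw [← mul_sub, ε.isUnit.dvd_mul_left]

theorem boundaryB_eq_zero_iff (φ φ' : Module.Dual ℤ (Fin (n + 1) → ℤ)) :
    (boundary _ (form_nondegenerate (n + 1) ε)).b (Submodule.Quotient.mk φ)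
      (Submodule.Quotient.mk φ') = 0 ↔ 8 ∣ ∑ i, coords n φ i * coords n φ' i := by
  change ((preB _ (form_nondegenerate (n + 1) ε) φ φ' : ℚ) : QmodZ) = 0 ↔ _
  rw [preB_form]
  refine (coe_div_eq_zero_iff (k := 8) (by norm_num) _).trans ?_
  rw [ε.isUnit.dvd_mul_left]

theorem boundaryB_intClass_eq_zero_iff (u v : Fin (n + 1) → ℤ) :
    (boundary _ (form_nondegenerate (n + 1) ε)).b (intClass ε u) (intClass ε v) = 0 ↔
      Even (oddSupp u ∩ oddSupp v).card := by
  rw [intClass_apply, intClass_apply, boundaryB_eq_zero_iff, ← even_sum_mul_iff,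
    coords_pairing, coords_pairing, even_iff_two_dvd]
  have : ∑ i, (2 • u) i * (2 • v) i = 4 * ∑ i, u i * v i := by
    rw [Finset.mul_sum]
    exact Finset.sum_congr rfl fun i _ => by simp; ring
  rw [this, show (8 : ℤ) = 4 * 2 by norm_num, mul_dvd_mul_iff_left (by norm_num)]

theorem sum_coords_pairing_sq (u : Fin (n + 1) → ℤ) :
    ∑ i, coords n (pairing n u) i ^ 2 = 4 * ∑ i, u i ^ 2 := by
  rw [coords_pairing, Finset.mul_sum]
  exact Finset.sum_congr rfl fun i _ => by simp; ring

/-- Elements with the same quadratic value as the class of a unit vector are represented by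
integral vectors whose norm is `1` modulo `4`. -/
theorem exists_intClass_of_boundaryν_eq (hn : (n + 1) % 8 ≠ 4) (x : Coker (form (n + 1) ε))
    (i : Fin (n + 1)) (hx : (boundary _ (form_nondegenerate (n + 1) ε)).ν x =
      (boundary _ (form_nondegenerate (n + 1) ε)).ν (intClass ε (Pi.single i 1))) :
    ∃ u, x = intClass ε u ∧ (oddSupp u).card % 4 = 1 := by
  have h1 : ∑ j, coords n (pairing n (Pi.single i 1)) j ^ 2 = 4 := by
    rw [sum_coords_pairing_sq, Finset.sum_eq_single i] <;> simp +contextual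
  obtain ⟨u, rfl | rfl⟩ := exists_eq_intClass ε x
  · refine ⟨u, rfl, ?_⟩
    rw [intClass_apply, intClass_apply, boundaryν_eq_iff, h1, sum_coords_pairing_sq] at hx
    have := four_dvd_sum_sq_sub_card_oddSupp u
    omega
  -- In the coset of `(1/2, …, 1/2)` the doubled coordinates are odd, so their squares sum to `n +
  -- 1` modulo 8. Equality of the quadratic values would force this sum to be 4 modulo 16, against
  -- `hn`.
  · exfalso
    rw [intClass_apply, intClass_apply, spinClass, ← Submodule.Quotient.mk_add,
      boundaryν_eq_iff, h1, map_add, coords_spin, coords_pairing] at hx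
    have h8 := eight_dvd_sum_sq_sub_card u
    have he : ∑ j, (2 • u + 1 : Fin (n + 1) → ℤ) j ^ 2 = ∑ j, (2 * u j + 1) ^ 2 := by simp
    rw [he] at hx
    rw [Fintype.card_fin] at h8
    omega

theorem boundaryν_intClass_eq_half {u : Fin (n + 1) → ℤ} (hu : (oddSupp u).card % 4 = 2) :
    (boundary _ (form_nondegenerate (n + 1) ε)).ν (intClass ε u) = ((1 / 2 : ℚ) : QmodZ) := by
  change ((preν _ (form_nondegenerate (n + 1) ε) (pairing n u) : ℚ) : QmodZ) = _
  rw [preν_form, sum_coords_pairing_sq]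
  have := four_dvd_sum_sq_sub_card_oddSupp u
  -- The norm of `u` is 2 modulo 4, so the numerator is `±8` modulo 16. The sign disappears because
  -- `1/2 = -1/2` in `ℚ/ℤ`.
  have h := (coe_div_eq_coe_div_iff (k := 16) (by norm_num) (ε * (4 * ∑ i, u i ^ 2)) 8).2 (by
    rcases Int.units_eq_one_or ε with rfl | rfl <;> push_cast <;> omega)
  refine Eq.trans ?_ (h.trans ?_) <;> norm_num

theorem two_smul_intClass_eq_zero {u : Fin (n + 1) → ℤ} (hu : (oddSupp u).card % 4 = 2) :
    (2 : ℤ) • intClass ε u = 0 := by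
  rw [← map_smul, intClass_eq_zero_iff]
  refine ⟨u, rfl, ?_⟩
  have h := even_sum_mul_iff u 1
  have h1 : oddSupp (1 : Fin (n + 1) → ℤ) = Finset.univ := by ext; simp [mem_oddSupp]
  simp only [h1, Finset.inter_univ, Pi.one_apply, mul_one] at h
  rw [h, Nat.even_iff]
  omega

instance {T : Type*} [AddCommGroup T] (L : SplitQuadraticLinkingForm T) :
    DistribMulAction L.Aut T := inferInstance

instance {T : Type*} [AddCommGroup T] (L : SplitQuadraticLinkingForm T) :
    MulAction L.Aut (Set T) := Set.mulActionSet

instance {T : Type*} [AddCommGroup T] (L : SplitQuadraticLinkingForm T) :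
    SMul L.Aut (Set T) := Set.smulSet

/-! ### Transvections -/

section Transvection

variable {T : Type*} [AddCommGroup T] (L : SplitQuadraticLinkingForm T) {w : T}

theorem SplitQuadraticLinkingForm.b_add_b_eq_zero (hw : (2 : ℤ) • w = 0) (x : T) :
    L.b x w + L.b x w = 0 := by
  rw [← _root_.map_add, ← two_smul ℤ, hw, map_zero]

/-- By polarisation `b(w, w) = ν(2w) - 2ν(w) = 0 - 1`, which vanishes in `ℚ/ℤ`. Hence adding `w`
does not change the pairing with `w`, and the transvection is an involution. -/
theorem SplitQuadraticLinkingForm.b_self_eq_zero (hw : (2 : ℤ) • w = 0)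
    (hν : L.ν w = ((1 / 2 : ℚ) : QmodZ)) : L.b w w = 0 := by
  have h0 : L.ν 0 = 0 := by simpa using L.map_smul 0 0
  rw [← L.map_add, ← two_smul ℤ, hw, h0, hν, zero_sub, ← neg_add', ← AddCircle.coe_add,
    neg_eq_zero, AddCircle.coe_eq_zero_iff]
  exact ⟨1, by norm_num⟩

theorem QmodZ_eq_half {a : QmodZ} (h : a + a = 0) (h0 : a ≠ 0) : a = ((1 / 2 : ℚ) : QmodZ) := by
  induction a using QuotientAddGroup.induction_on with
  | H q =>
  rw [← AddCircle.coe_add, AddCircle.coe_eq_zero_iff] at h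
  obtain ⟨k, hk⟩ := h
  rw [zsmul_eq_mul, mul_one] at hk
  rcases Int.even_or_odd' k with ⟨c, rfl | rfl⟩
  · refine absurd ((AddCircle.coe_eq_zero_iff _).2 ⟨c, ?_⟩) h0
    push_cast at hk
    rw [zsmul_eq_mul, mul_one]
    linarith
  · rw [← sub_eq_zero]
    change ((q : ℚ) : QmodZ) - _ = 0
    rw [← AddCircle.coe_sub, AddCircle.coe_eq_zero_iff]
    refine ⟨c, ?_⟩
    push_cast at hk
    rw [zsmul_eq_mul, mul_one]
    linarith

open Classical in
/-- The map adding `w` to the elements not orthogonal to `w`. -/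
def transvectionHom (hw : (2 : ℤ) • w = 0) : T →+ T :=
  AddMonoidHom.mk' (fun x => if L.b x w = 0 then x else x + w) (fun x y => by
    have hww : w + w = 0 := by rw [← two_smul ℤ, hw]
    have hx := L.b_add_b_eq_zero hw x
    have hy := L.b_add_b_eq_zero hw y
    simp only [map_add, AddMonoidHom.add_apply]
    by_cases h1 : L.b x w = 0 <;> by_cases h2 : L.b y w = 0
    · simp [h1, h2]
    · simp [h1, h2, add_assoc]
    · simp [h1, h2]; abel
    -- Both pairings are the unique element `1/2` of order two, so they cancel, as do the two added
    -- copies of `w`.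
    · have h3 : L.b x w + L.b y w = 0 := by
        rw [QmodZ_eq_half hy h2, ← QmodZ_eq_half hx h1, hx]
      rw [if_pos h3, if_neg h1, if_neg h2, add_add_add_comm, hww, add_zero])

theorem transvectionHom_of_eq_zero (hw : (2 : ℤ) • w = 0) {x : T} (h : L.b x w = 0) :
    transvectionHom L hw x = x := if_pos h

theorem transvectionHom_of_ne_zero (hw : (2 : ℤ) • w = 0) {x : T} (h : L.b x w ≠ 0) :
    transvectionHom L hw x = x + w := if_neg h

theorem transvectionHom_involutive (hw : (2 : ℤ) • w = 0)
    (hν : L.ν w = ((1 / 2 : ℚ) : QmodZ)) : Function.Involutive (transvectionHom L hw) := by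
  intro x
  by_cases h : L.b x w = 0
  · rw [transvectionHom_of_eq_zero L hw h, transvectionHom_of_eq_zero L hw h]
  · rw [transvectionHom_of_ne_zero L hw h, transvectionHom_of_ne_zero L hw, add_assoc,
      ← two_smul ℤ, hw, add_zero]
    rwa [map_add, AddMonoidHom.add_apply, L.b_self_eq_zero hw hν, add_zero]

/-- When `b(x, w) = 1/2`, the terms `ν(w) = 1/2` and `b(x, w)` in the expansion of `ν(x + w)`
cancel. -/
theorem ν_transvectionHom (hw : (2 : ℤ) • w = 0) (hν : L.ν w = ((1 / 2 : ℚ) : QmodZ)) (x : T) :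
    L.ν (transvectionHom L hw x) = L.ν x := by
  by_cases h : L.b x w = 0
  · rw [transvectionHom_of_eq_zero L hw h]
  · rw [transvectionHom_of_ne_zero L hw h]
    have h1 := L.map_add x w
    have h2 := L.b_add_b_eq_zero hw x
    rw [QmodZ_eq_half h2 h] at h1 h2
    rw [hν, sub_sub, sub_eq_iff_eq_add] at h1
    rw [h1, add_left_comm, h2, add_zero]

/-- The transvection along an element `w` of order two with quadratic value `1/2`. -/
def transvection (hw : (2 : ℤ) • w = 0) (hν : L.ν w = ((1 / 2 : ℚ) : QmodZ)) : L.Aut :=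
  ⟨LinearEquiv.ofInvolutive (transvectionHom L hw).toIntLinearMap
    (transvectionHom_involutive L hw hν), by
    have key (x : T) : L.ν (transvectionHom L hw x) = L.ν x := ν_transvectionHom L hw hν x
    refine ⟨fun x y => ?_, key⟩
    change L.b (transvectionHom L hw x) (transvectionHom L hw y) = L.b x y
    -- The linking form is the polarisation of `ν`, so preserving `ν` is enough.
    rw [← L.map_add, ← L.map_add, ← map_add, key, key, key]⟩

end Transvection

/-! ### Isometries from orthogonal transformations -/

theorem even_sum_iff_even_sum_sq (v : Fin (n + 1) → ℤ) :
    Even (∑ i, v i) ↔ Even (∑ i, v i ^ 2) := by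
  rw [← Int.even_sub, even_iff_two_dvd, ← Finset.sum_sub_distrib]
  refine Finset.dvd_sum fun i _ => ?_
  rw [← even_iff_two_dvd]
  rw [← even_neg, show -(v i - v i ^ 2) = v i * (v i - 1) by ring]
  exact Int.even_mul_pred_self (v i)

/-- The coordinate sum and the norm of an integral vector have the same parity, so a norm-preserving
automorphism of `ℤ^h` preserves `D_h`. -/
theorem exists_aut_of_isometry (P : (Fin (n + 1) → ℤ) ≃ₗ[ℤ] (Fin (n + 1) → ℤ))
    (hP : ∀ v, ∑ i, P v i ^ 2 = ∑ i, v i ^ 2) :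
    ∃ g : Aut (form (n + 1) ε), ∀ x, euclid n (g.1 x) = P (euclid n x) := by
  have hmap : (LinearMap.range (euclid n)).map (P : (Fin (n + 1) → ℤ) →ₗ[ℤ] _) =
      LinearMap.range (euclid n) := by
    ext v
    rw [Submodule.mem_map_equiv, mem_range_euclid, mem_range_euclid, even_sum_iff_even_sum_sq,
      even_sum_iff_even_sum_sq v, ← hP (P.symm v), P.apply_symm_apply]
  let e := LinearEquiv.ofInjective (euclid n) euclid_injective
  let g := e ≪≫ₗ LinearEquiv.ofSubmodules P _ _ hmap ≪≫ₗ e.symm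
  have hg (x : Fin (n + 1) → ℤ) : euclid n (g x) = P (euclid n x) := by
    change ((e (e.symm _) : LinearMap.range (euclid n)) : Fin (n + 1) → ℤ) = _
    rw [e.apply_symm_apply]
    rfl
  refine ⟨⟨g, QuadraticQ.ext_quadValue fun x => ?_⟩, hg⟩
  rw [quadValue_pullback, quadValue_form, quadValue_form]
  change _ * ∑ i, euclid n (g x) i ^ 2 = _
  rw [hg, hP]

/-- The linear map permuting the coordinates and changing their signs. -/
def signedPerm {ι : Type*} (π : Equiv.Perm ι) (σ : ι → ℤˣ) : (ι → ℤ) ≃ₗ[ℤ] (ι → ℤ) :=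
  LinearEquiv.piCongrRight (fun i => LinearEquiv.smulOfUnit (σ i)) ≪≫ₗ
    LinearEquiv.funCongrLeft ℤ ℤ π.symm

theorem signedPerm_apply {ι : Type*} (π : Equiv.Perm ι) (σ : ι → ℤˣ) (v : ι → ℤ) (i : ι) :
    signedPerm π σ v i = σ (π.symm i) * v (π.symm i) := rfl

theorem signedPerm_single {ι : Type*} [DecidableEq ι] (π : Equiv.Perm ι) (σ : ι → ℤˣ) (i : ι) :
    signedPerm π σ (Pi.single i 1) = Pi.single (π i) (σ i : ℤ) := by
  ext j
  rw [signedPerm_apply]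
  by_cases h : j = π i
  · subst h; simp
  · have : π.symm j ≠ i := fun h' => h (by rw [← h', π.apply_symm_apply])
    simp [h, this]

theorem sum_signedPerm_mul {ι : Type*} [Fintype ι] (π : Equiv.Perm ι) (σ : ι → ℤˣ)
    (u v : ι → ℤ) : ∑ i, signedPerm π σ u i * signedPerm π σ v i = ∑ i, u i * v i := by
  rw [← Equiv.sum_comp π.symm (fun i => u i * v i)]
  refine Finset.sum_congr rfl fun i _ => ?_
  rw [signedPerm_apply, signedPerm_apply]
  linear_combination (u (π.symm i) * v (π.symm i)) * units_mul_self (σ (π.symm i))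

theorem exists_boundaryMap_intClass (π : Equiv.Perm (Fin (n + 1))) (σ : Fin (n + 1) → ℤˣ) :
    ∃ g : Aut (form (n + 1) ε), ∀ u,
      boundaryMap _ (form_nondegenerate (n + 1) ε) g • intClass ε u =
        intClass ε (signedPerm π σ u) := by
  obtain ⟨g, hg⟩ := exists_aut_of_isometry ε (signedPerm π σ) (fun v => by
    simpa only [sq] using sum_signedPerm_mul π σ v v)
  refine ⟨g, fun u => ?_⟩
  change cokerEquiv _ g (intClass ε u) = _
  rw [intClass_apply, cokerEquiv_mk, intClass_apply]
  congr 1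
  ext1 x
  obtain ⟨y, hy⟩ := g.1.surjective (Pi.single x 1)
  refine LinearMap.ext_ring ?_
  change pairing n u (g.1.symm (Pi.single x 1)) = pairing n (signedPerm π σ u) (Pi.single x 1)
  rw [← hy, g.1.symm_apply_apply, pairing_apply, pairing_apply, hg, sum_signedPerm_mul]

/-! ### Frames -/

/-- The set of classes of integral vectors whose odd support lies in a given family. -/
def frame (𝒲 : Set (Finset (Fin (n + 1)))) : Set (Coker (form (n + 1) ε)) :=
  {x | ∃ u, x = intClass ε u ∧ oddSupp u ∈ 𝒲}

theorem intClass_mem_frame_iff {𝒲 : Set (Finset (Fin (n + 1)))} {u : Fin (n + 1) → ℤ} :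
    intClass ε u ∈ frame ε 𝒲 ↔ oddSupp u ∈ 𝒲 := by
  constructor
  · rintro ⟨v, hv, h⟩
    rwa [oddSupp_eq_of_intClass_eq ε hv]
  · exact fun h => ⟨u, rfl, h⟩

/-- The set of classes of the unit vectors and their negatives. -/
def unitFrame (n : ℕ) (ε : ℤˣ) : Set (Coker (form (n + 1) ε)) := frame ε {W | W.card = 1}

theorem intClass_single_mem_unitFrame (i : Fin (n + 1)) :
    intClass ε (Pi.single i 1) ∈ unitFrame n ε := by
  rw [unitFrame, intClass_mem_frame_iff, oddSupp_single]
  exact Finset.card_singleton i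

/-- A lattice isometry preserves the rational number `preν`, not only its class modulo 1, so the
image of `±e_i` in `D_h^*` still has norm 1. An integral vector of norm 1 has a single odd
coordinate, and a vector in the coset of `(1/2, …, 1/2)` has norm at least `(n + 1)/4 > 1`. -/
theorem boundaryMap_smul_mem_unitFrame (hn : 4 ≤ n) (g : Aut (form (n + 1) ε))
    {x : Coker (form (n + 1) ε)} (hx : x ∈ unitFrame n ε) :
    boundaryMap _ (form_nondegenerate (n + 1) ε) g • x ∈ unitFrame n ε := by
  obtain ⟨u, rfl, hu⟩ := hx
  obtain ⟨i, σ, h⟩ := intClass_eq_of_card_oddSupp_eq_one ε hu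
  rw [h]
  change cokerEquiv _ g (intClass ε _) ∈ _
  rw [intClass_apply, cokerEquiv_mk]
  set φ := pairing n (Pi.single i (σ : ℤ))
  set φ' := g.1.symm.dualMap φ
  have hν : preν _ (form_nondegenerate (n + 1) ε) φ' =
      preν _ (form_nondegenerate (n + 1) ε) φ := by
    rw [preν_eq _ _ φ' _ _ (den_ne_zero _ (form_nondegenerate (n + 1) ε) φ)
      (by rw [← map_smul, den_smul, adjoint_isometry]), quadValue_isometry, preν]
  have hN : ∑ j, coords n φ' j ^ 2 = 4 := by
    rw [preν_form, preν_form, div_left_inj' (by norm_num), Int.cast_inj,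
      mul_right_inj' ε.ne_zero, sum_coords_pairing_sq] at hν
    rw [hν, Finset.sum_eq_single i]
    · rcases Int.units_eq_one_or σ with rfl | rfl <;> simp
    · simp +contextual
    · simp
  obtain ⟨v, hv | hv⟩ := eq_pairing_or_eq_pairing_add_spin φ'
  · rw [hv] at hN ⊢
    refine ⟨v, rfl, ?_⟩
    rw [sum_coords_pairing_sq] at hN
    have h1 := four_dvd_sum_sq_sub_card_oddSupp v
    have h2 := card_oddSupp_le_sum_sq v
    change (oddSupp v).card = 1
    omega
  · exfalso
    have h1 : ∑ j : Fin (n + 1), (1 : ℤ) ≤ ∑ j, coords n φ' j ^ 2 := by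
      refine Finset.sum_le_sum fun j _ => ?_
      have h3 : coords n φ' j = 2 * v j + 1 := by
        rw [hv, map_add, coords_pairing, coords_spin]
        simp
      have h4 : coords n φ' j ≠ 0 := by omega
      have := sq_pos_of_ne_zero h4
      omega
    rw [hN] at h1
    simp at h1
    omega

/-- The integral classes are fixed because the `e_i` generate them. The class of `(1/2, …, 1/2)` is
then fixed because its pairings with the `e_i` and its quadratic value determine it. -/
theorem eq_one_of_smul_intClass_single (f : (boundary _ (form_nondegenerate (n + 1) ε)).Aut)
    (hf : ∀ i : Fin (n + 1), f • intClass ε (Pi.single i 1) = intClass ε (Pi.single i 1)) : f = 1 := by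
  have hint (u : Fin (n + 1) → ℤ) : f • intClass ε u = intClass ε u := by
    have : f.1.toLinearMap ∘ₗ intClass ε = intClass ε :=
      LinearMap.pi_ext' fun i => LinearMap.ext_ring (hf i)
    exact LinearMap.congr_fun this u
  have hspin : f • spinClass n ε = spinClass n ε := by
    obtain ⟨φ, hφ⟩ := Submodule.Quotient.mk_surjective _ (f • spinClass n ε)
    rw [← hφ]
    have hν := f.2.2 (spinClass n ε)
    change (boundary _ (form_nondegenerate (n + 1) ε)).ν (f • spinClass n ε) = _ at hν
    rw [← hφ, spinClass, boundaryν_eq_iff, coords_spin, ← Finset.sum_sub_distrib] at hν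
    -- Pairing with `e_i` determines the `i`-th doubled coordinate modulo 4.
    have hb (i : Fin (n + 1)) : ∃ k, coords n φ i = 1 + 4 * k := by
      have h1 := f.2.1 (spinClass n ε) (intClass ε (Pi.single i 1))
      change (boundary _ (form_nondegenerate (n + 1) ε)).b (f • spinClass n ε)
        (f • intClass ε (Pi.single i 1)) = _ at h1
      rw [hf, ← sub_eq_zero, ← AddMonoidHom.sub_apply, ← map_sub, ← hφ, spinClass,
        ← Submodule.Quotient.mk_sub, intClass_apply, boundaryB_eq_zero_iff, map_sub,
        coords_spin, coords_pairing, Finset.sum_eq_single i] at h1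
      · simp at h1
        exact ⟨(coords n φ i - 1) / 4, by omega⟩
      · simp +contextual
      · simp
    choose k hk using hb
    rw [spinClass, ← sub_eq_zero, ← Submodule.Quotient.mk_sub, Submodule.Quotient.mk_eq_zero,
      mem_range_adjoint_form, map_sub, coords_spin]
    refine ⟨k, by ext i; simp [hk i], ?_⟩
    -- Since `(1 + 4k)² - 1 = 8k + 16k²`, equality of the quadratic values modulo 16 makes the sum
    -- of the `k i` even, as membership in `4D_h` requires.
    have h16 : 16 ∣ ∑ i, (coords n φ i ^ 2 - (1 : Fin (n + 1) → ℤ) i ^ 2) - 8 * ∑ i, k i := by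
      rw [Finset.mul_sum, ← Finset.sum_sub_distrib]
      refine Finset.dvd_sum fun i _ => ⟨k i ^ 2, ?_⟩
      rw [hk i, Pi.one_apply]
      ring
    rw [even_iff_two_dvd]
    omega
  refine Subtype.ext (LinearEquiv.ext fun x => ?_)
  change f • x = x
  obtain ⟨u, rfl | rfl⟩ := exists_eq_intClass ε x
  · exact hint u
  · rw [smul_add, hint, hspin]

/-- Such an `f` acts on the classes of the `e_i` by a signed permutation. The corresponding lattice
isometry induces the same map on these classes, hence equals `f` on the whole boundary. -/
theorem mem_range_boundaryMap_of_smul_unitFrame_subset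
    (f : (boundary _ (form_nondegenerate (n + 1) ε)).Aut)
    (hf : ∀ x ∈ unitFrame n ε, f • x ∈ unitFrame n ε) :
    f ∈ (boundaryMap _ (form_nondegenerate (n + 1) ε)).range := by
  have h (i : Fin (n + 1)) : ∃ (j : Fin (n + 1)) (σ : ℤˣ),
      f • intClass ε (Pi.single i 1) = intClass ε (Pi.single j (σ : ℤ)) := by
    obtain ⟨u, hu, hc⟩ := hf _ (intClass_single_mem_unitFrame ε i)
    rw [hu]
    exact intClass_eq_of_card_oddSupp_eq_one ε hc
  choose p σ hp using h
  have hsupp (i : Fin (n + 1)) (τ : ℤˣ) : oddSupp (Pi.single i (τ : ℤ)) = {i} := by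
    rcases Int.units_eq_one_or τ with rfl | rfl
    · exact oddSupp_single i
    · rw [Units.val_neg, Units.val_one, Pi.single_neg, oddSupp_neg, oddSupp_single]
  have hmul (i : Fin (n + 1)) (τ : ℤ) : f • intClass ε (Pi.single i τ) =
      τ • intClass ε (Pi.single (p i) (σ i : ℤ)) := by
    rw [← hp, smul_comm, ← map_smul (intClass ε), ← Pi.single_smul, smul_eq_mul, mul_one]
  have hinj : Function.Injective p := by
    intro i j hij
    -- Multiplying by the signs makes both images equal to the class of the same unit vector.
    have h1 : f • intClass ε (Pi.single i (σ i : ℤ)) =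
        f • intClass ε (Pi.single j (σ j : ℤ)) := by
      rw [hmul, hmul, ← map_smul, ← map_smul, ← Pi.single_smul, ← Pi.single_smul, smul_eq_mul,
        smul_eq_mul, units_mul_self, units_mul_self, hij]
    have h2 := oddSupp_eq_of_intClass_eq ε (MulAction.injective f h1)
    rwa [hsupp, hsupp, Finset.singleton_inj] at h2
  let π := Equiv.ofBijective p (Finite.injective_iff_bijective.1 hinj)
  obtain ⟨g, hg⟩ := exists_boundaryMap_intClass ε π σ
  refine ⟨g, (inv_mul_eq_one.1 (eq_one_of_smul_intClass_single ε _ fun i => ?_))⟩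
  rw [mul_smul, inv_smul_eq_iff, hp, hg, signedPerm_single]
  rfl

theorem stabilizer_unitFrame (hn : 4 ≤ n) :
    MulAction.stabilizer (boundary _ (form_nondegenerate (n + 1) ε)).Aut (unitFrame n ε) =
      (boundaryMap _ (form_nondegenerate (n + 1) ε)).range := by
  ext f
  constructor
  · intro hf
    refine mem_range_boundaryMap_of_smul_unitFrame_subset ε f fun x hx => ?_
    rw [← MulAction.mem_stabilizer_iff.1 hf]
    exact Set.smul_mem_smul_set hx
  · rintro ⟨g, rfl⟩
    rw [MulAction.mem_stabilizer_iff]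
    refine Set.Subset.antisymm ?_ fun x hx => ?_
    · rintro _ ⟨x, hx, rfl⟩
      exact boundaryMap_smul_mem_unitFrame ε hn g hx
    · rw [Set.mem_smul_set_iff_inv_smul_mem, ← map_inv]
      exact boundaryMap_smul_mem_unitFrame ε hn g⁻¹ hx

/-! ### The orbit of the unit frame -/

/-- Preservation of `ν` forces the sizes modulo 4, and orthogonality of distinct `e_i` forces the
even intersections. -/
theorem exists_oddSupp_of_aut (hn : (n + 1) % 8 ≠ 4)
    (f : (boundary _ (form_nondegenerate (n + 1) ε)).Aut) :
    ∃ u : Fin (n + 1) → Fin (n + 1) → ℤ, (∀ i, f • intClass ε (Pi.single i 1) = intClass ε (u i)) ∧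
      (∀ i, (oddSupp (u i)).card % 4 = 1) ∧
      ∀ i j, i ≠ j → Even (oddSupp (u i) ∩ oddSupp (u j)).card := by
  choose u hu hc using fun i : Fin (n + 1) =>
    exists_intClass_of_boundaryν_eq ε hn (f • intClass ε (Pi.single i 1)) i (f.2.2 _)
  refine ⟨u, hu, hc, fun i j hij => ?_⟩
  rw [← boundaryB_intClass_eq_zero_iff ε, ← hu, ← hu]
  refine (f.2.1 _ _).trans ?_
  rw [boundaryB_intClass_eq_zero_iff, oddSupp_single, oddSupp_single,
    Finset.singleton_inter_of_notMem (by simpa using hij)]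
  simp

theorem smul_unitFrame_subset {𝒲 : Set (Finset (Fin (n + 1)))}
    (f : (boundary _ (form_nondegenerate (n + 1) ε)).Aut) (u : Fin (n + 1) → Fin (n + 1) → ℤ)
    (hu : ∀ i, f • intClass ε (Pi.single i 1) = intClass ε (u i)) (h𝒲 : ∀ i, oddSupp (u i) ∈ 𝒲) :
    f • unitFrame n ε ⊆ frame ε 𝒲 := by
  rintro _ ⟨_, ⟨v, rfl, hv⟩, rfl⟩
  obtain ⟨i, σ, h⟩ := intClass_eq_of_card_oddSupp_eq_one ε hv
  change f • intClass ε v ∈ _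
  rw [h]
  rcases Int.units_eq_one_or σ with rfl | rfl
  · rw [Units.val_one, hu, intClass_mem_frame_iff]
    exact h𝒲 i
  · rw [Units.val_neg, Units.val_one, Pi.single_neg, map_neg, smul_neg, hu, ← map_neg,
      intClass_mem_frame_iff, oddSupp_neg]
    exact h𝒲 i

/-- If a transvection exchanges a family of supports with the singletons, then the corresponding
frame is a translate of the unit frame. -/
theorem exists_smul_unitFrame_eq {𝒲 : Set (Finset (Fin (n + 1)))} (K : Finset (Fin (n + 1)))
    (hK : K.card % 4 = 2)
    (h1 : ∀ W ∈ 𝒲, if Even (W ∩ K).card then W.card = 1 else (symmDiff W K).card = 1)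
    (h2 : ∀ W, W.card = 1 → if Even (W ∩ K).card then W ∈ 𝒲 else symmDiff W K ∈ 𝒲) :
    ∃ a : (boundary _ (form_nondegenerate (n + 1) ε)).Aut, a • unitFrame n ε = frame ε 𝒲 := by
  set k : Fin (n + 1) → ℤ := fun i => if i ∈ K then 1 else 0 with hk
  have hkK : oddSupp k = K := oddSupp_indicator K
  have hkc : (oddSupp k).card % 4 = 2 := by rw [hkK, hK]
  set L := boundary _ (form_nondegenerate (n + 1) ε)
  have hw := two_smul_intClass_eq_zero ε hkc
  have hν := boundaryν_intClass_eq_half ε hkc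
  -- On odd supports the transvection along the indicator of `K` fixes `W` if `W ∩ K` has even size,
  -- and otherwise replaces it by the symmetric difference with `K`.
  have hτ (u : Fin (n + 1) → ℤ) : transvectionHom L hw (intClass ε u) =
      if Even (oddSupp u ∩ K).card then intClass ε u else intClass ε (u + k) := by
    have hb := boundaryB_intClass_eq_zero_iff ε u k
    rw [hkK] at hb
    split_ifs with h
    · exact transvectionHom_of_eq_zero L hw (hb.2 h)
    · rw [transvectionHom_of_ne_zero L hw (mt hb.1 h), map_add]
  refine ⟨transvection L hw hν, Set.Subset.antisymm ?_ ?_⟩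
  · rintro _ ⟨_, ⟨u, rfl, hu⟩, rfl⟩
    change transvectionHom L hw (intClass ε u) ∈ _
    rw [hτ]
    have h := h2 _ hu
    split_ifs at h ⊢
    · rwa [intClass_mem_frame_iff]
    · rwa [intClass_mem_frame_iff, oddSupp_add, hkK]
  · rintro _ ⟨u, rfl, hu⟩
    refine ⟨transvectionHom L hw (intClass ε u), ?_, transvectionHom_involutive L hw hν _⟩
    rw [hτ, unitFrame]
    have h := h1 _ hu
    split_ifs at h ⊢
    · rwa [intClass_mem_frame_iff]
    · rwa [intClass_mem_frame_iff, oddSupp_add, hkK]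

theorem finite_boundary : Finite (Coker (form (n + 1) ε)) :=
  finite_coker _ (form_nondegenerate (n + 1) ε)

/-- If the translates of the unit frame are the members of an injective family of frames, then
the number of these is the index of the image of the boundary map. -/
theorem index_range_boundaryMap (hn : 4 ≤ n) {κ : Type*}
    (𝒲 : κ → Set (Finset (Fin (n + 1))))
    (hinj : Function.Injective fun k => frame ε (𝒲 k))
    (htrans : ∀ k, ∃ a : (boundary _ (form_nondegenerate (n + 1) ε)).Aut,
      a • unitFrame n ε = frame ε (𝒲 k))
    (hsub : ∀ f : (boundary _ (form_nondegenerate (n + 1) ε)).Aut,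
      ∃ k, f • unitFrame n ε ⊆ frame ε (𝒲 k)) :
    (boundaryMap _ (form_nondegenerate (n + 1) ε)).range.index = Nat.card κ := by
  have := finite_boundary (n := n) ε
  rw [← stabilizer_unitFrame ε hn, MulAction.index_stabilizer]
  have : MulAction.orbit (boundary _ (form_nondegenerate (n + 1) ε)).Aut (unitFrame n ε) =
      Set.range fun k => frame ε (𝒲 k) := by
    ext F
    constructor
    · rintro ⟨f, rfl⟩
      obtain ⟨k, hk⟩ := hsub f
      obtain ⟨a, ha⟩ := htrans k
      -- The inclusion is an equality, because both sides are translates of the unit frame and so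
      -- have the same finite cardinality.
      refine ⟨k, (Set.eq_of_subset_of_ncard_le hk ?_ (Set.toFinite _)).symm⟩
      rw [← ha, Set.ncard_smul_set, Set.ncard_smul_set]
    · rintro ⟨k, rfl⟩
      exact htrans k
  rw [this, ← Set.image_univ, Set.ncard_image_of_injective _ hinj, Set.ncard_univ]

/-- The orbit of the identity is the image of the boundary map, so an element outside the image lies
in another orbit. -/
theorem nontrivial_bAut_of_not_surjective {V : Type*} [AddCommGroup V] [Module.Free ℤ V]
    [Module.Finite ℤ V] (ψ : QuadraticQ V) (hψ : Nondegenerate ψ)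
    (h : ¬ Function.Surjective (boundaryMap ψ hψ)) : Nontrivial (BAut ψ hψ) := by
  obtain ⟨f, hf⟩ := not_forall.1 h
  let _ := boundaryAction ψ hψ
  refine ⟨⟨Quotient.mk _ f, Quotient.mk _ 1, fun he => hf ?_⟩⟩
  obtain ⟨⟨a, b⟩, hab⟩ := Quotient.exact he
  refine ⟨a * b⁻¹, ?_⟩
  rw [map_mul, map_inv, ← hab]
  change _ = boundaryMap ψ hψ a * 1 * (boundaryMap ψ hψ b)⁻¹
  rw [mul_one]

theorem not_surjective_of_index_range {G H : Type*} [Group G] [Group H] (f : G →* H)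
    (h : f.range.index ≠ 1) : ¬ Function.Surjective f := by
  rwa [← MonoidHom.range_eq_top, ← Subgroup.index_eq_one]

/-! ### Dimension six -/

/-- A singleton and a five-element set with even intersection are complementary, and the sets are
distinct because their sizes are odd. If both sizes occurred, a third set would have to coincide
with one of these two. -/
theorem card_eq_of_even_inter (W : Fin 6 → Finset (Fin 6)) (hc : ∀ i, (W i).card % 4 = 1)
    (he : ∀ i j, i ≠ j → Even (W i ∩ W j).card) :
    (∀ i, (W i).card = 1) ∨ ∀ i, (W i).card = 5 := by
  have hc' (i : Fin 6) : (W i).card = 1 ∨ (W i).card = 5 := by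
    have h1 := hc i
    have h2 := Finset.card_le_univ (W i)
    rw [Fintype.card_fin] at h2
    omega
  have mixed {i j : Fin 6} (hi : (W i).card = 1) (hj : (W j).card = 5) : W i = (W j)ᶜ := by
    have hij : i ≠ j := by rintro rfl; omega
    have h1 := Finset.card_le_card (Finset.inter_subset_left (s₁ := W i) (s₂ := W j))
    have h2 := he i j hij
    rw [Nat.even_iff] at h2
    refine Finset.eq_of_subset_of_card_le ?_ (by rw [Finset.card_compl, hi, hj]; rfl)
    rw [Finset.subset_compl_iff_disjoint_right, Finset.disjoint_iff_inter_eq_empty,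
      ← Finset.card_eq_zero]
    omega
  have noeq {i j : Fin 6} (hij : i ≠ j) : W i ≠ W j := by
    intro h
    have h2 := he i j hij
    rw [h, Finset.inter_self, Nat.even_iff] at h2
    have := hc j
    omega
  by_contra! h
  obtain ⟨⟨j, hj⟩, ⟨i, hi⟩⟩ := h
  have hj := (hc' j).resolve_left hj
  have hi := (hc' i).resolve_right hi
  obtain ⟨k, hki, hkj⟩ : ∃ k, k ≠ i ∧ k ≠ j := by
    have hlt : ({i, j} : Finset (Fin 6)).card < (Finset.univ : Finset (Fin 6)).card :=
      Finset.card_le_two.trans_lt (by simp)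
    obtain ⟨k, -, hk⟩ := Finset.exists_mem_notMem_of_card_lt_card hlt
    exact ⟨k, by simpa using hk⟩
  rcases hc' k with hk | hk
  · exact noeq hki ((mixed hk hj).trans (mixed hi hj).symm)
  · exact noeq hkj (compl_injective ((mixed hi hk).symm.trans (mixed hi hj)))

theorem index_range_boundaryMap_six :
    (boundaryMap (form 6 ε) (form_nondegenerate 6 ε)).range.index = 2 := by
  let 𝒲 : Bool → Set (Finset (Fin 6)) := fun k => {W | W.card = bif k then 5 else 1}
  rw [index_range_boundaryMap (n := 5) ε (by norm_num) 𝒲, Nat.card_eq_fintype_card,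
    Fintype.card_bool]
  -- The class of `e_0` lies in the frame of singletons but not in the other one.
  · have key (k : Bool) : intClass ε (Pi.single (0 : Fin 6) 1) ∈ frame ε (𝒲 k) ↔ k = false := by
      rw [intClass_mem_frame_iff, oddSupp_single]
      cases k <;> simp [𝒲]
    intro k l hkl
    have h : frame ε (𝒲 k) = frame ε (𝒲 l) := hkl
    have := key k
    rw [h, key] at this
    cases k <;> cases l <;> simp_all
  · rintro (_ | _)
    · exact ⟨1, one_smul _ _⟩
    -- The transvection along `(1, …, 1)` complements every support of odd size.
    · refine exists_smul_unitFrame_eq ε Finset.univ rfl ?_ ?_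
      · intro W hW
        have hW' : W.card = 5 := hW
        have hs : symmDiff W Finset.univ = Wᶜ := symmDiff_top W
        simp [hW', hs, Finset.card_compl, Nat.even_iff]
      · intro W hW
        have hs : symmDiff W Finset.univ = Wᶜ := symmDiff_top W
        simp [hW, hs, Finset.card_compl, 𝒲]
  · intro f
    obtain ⟨u, hu, hc, he⟩ := exists_oddSupp_of_aut ε (by norm_num) f
    rcases card_eq_of_even_inter _ hc he with h | h
    · exact ⟨false, smul_unitFrame_subset ε f u hu h⟩
    · exact ⟨true, smul_unitFrame_subset ε f u hu h⟩

/-! ### Dimension seven -/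

/-- Four or more two-element sets, any two of which have exactly one common element, have a
common element. -/
theorem exists_common_mem {ι α : Type*} [Fintype ι] [DecidableEq α] (hι : 4 ≤ Fintype.card ι)
    (P : ι → Finset α) (h2 : ∀ i, (P i).card = 2)
    (h1 : ∀ i j, i ≠ j → (P i ∩ P j).card = 1) : ∃ v, ∀ i, v ∈ P i := by
  classical
  have avoid (s : Finset ι) (hs : s.card < 4) : ∃ l, l ∉ s := by
    obtain ⟨l, -, hl⟩ := Finset.exists_mem_notMem_of_card_lt_card
      (s := s) (t := Finset.univ) (by rw [Finset.card_univ]; omega)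
    exact ⟨l, hl⟩
  have meet (i j : ι) (hij : i ≠ j) : ∃ x, x ∈ P i ∧ x ∈ P j := by
    obtain ⟨x, hx⟩ := Finset.card_pos.1 ((h1 i j hij).symm ▸ one_pos)
    exact ⟨x, Finset.mem_inter.1 hx⟩
  have uniq (i j : ι) (hij : i ≠ j) {x y : α} (hx : x ∈ P i) (hx' : x ∈ P j) (hy : y ∈ P i)
      (hy' : y ∈ P j) : x = y :=
    Finset.card_le_one.1 (h1 i j hij).le x (Finset.mem_inter.2 ⟨hx, hx'⟩) y
      (Finset.mem_inter.2 ⟨hy, hy'⟩)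
  have pair (i : ι) {x y z : α} (hx : x ∈ P i) (hy : y ∈ P i) (hz : z ∈ P i) :
      x = y ∨ x = z ∨ y = z := by
    by_contra! h
    have := Finset.two_lt_card.2 ⟨x, hx, y, hy, z, hz, h.1, h.2.1, h.2.2⟩
    exact this.ne' (h2 i)
  obtain ⟨i, -⟩ := avoid ∅ (by simp)
  obtain ⟨j, hj⟩ := avoid {i} (by simp)
  obtain ⟨v, hvi, hvj⟩ := meet i j (by grind)
  refine ⟨v, fun k => ?_⟩
  by_contra hvk
  have hki : k ≠ i := by grind
  have hkj : k ≠ j := by grind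
  obtain ⟨a, hak, hai⟩ := meet k i hki
  obtain ⟨b, hbk, hbj⟩ := meet k j hkj
  -- The edges `P i = {v, a}`, `P j = {v, b}`, `P k = {a, b}` form a triangle. A fourth edge meeting
  -- all three contains two vertices of the triangle, so it shares two vertices with one of them.
  obtain ⟨l, hl⟩ := avoid {i, j, k} (Finset.card_le_three.trans_lt (by norm_num))
  have hli : l ≠ i := by grind
  have hlj : l ≠ j := by grind
  have hlk : l ≠ k := by grind
  have hav : a ≠ v := fun h => hvk (h ▸ hak)
  have hbv : b ≠ v := fun h => hvk (h ▸ hbk)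
  have hab : a ≠ b := fun h => hav (uniq i j (by grind) hai (h ▸ hbj) hvi hvj)
  obtain ⟨c, hcl, hci⟩ := meet l i hli
  obtain ⟨d, hdl, hdj⟩ := meet l j hlj
  obtain ⟨e, hel, hek⟩ := meet l k hlk
  rcases pair k hak hbk hek with h | rfl | rfl
  · exact hab h
  · rcases pair j hvj hbj hdj with h | rfl | rfl
    · exact hbv h.symm
    · exact hav (uniq l i hli hel hai hdl hvi)
    · exact hab (uniq l k hlk hel hak hdl hbk)
  · rcases pair i hvi hai hci with h | rfl | rfl
    · exact hav h.symm
    · exact hbv (uniq l j hlj hel hbj hcl hvj)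
    · exact hab (uniq l k hlk hcl hak hel hbk)

/-- The edge of the complete graph on eight vertices corresponding to a set of one or five out of
seven elements: a set of one element is joined with the additional vertex, and a set of five
elements is replaced by its complement. -/
def edge (W : Finset (Fin 7)) : Finset (Option (Fin 7)) :=
  if W.card = 1 then W.insertNone else Wᶜ.map Function.Embedding.some

theorem none_mem_edge {W : Finset (Fin 7)} : none ∈ edge W ↔ W.card = 1 := by
  unfold edge
  split_ifs with h <;> simp [h]

theorem some_mem_edge {W : Finset (Fin 7)} {a : Fin 7} :
    some a ∈ edge W ↔ if W.card = 1 then a ∈ W else a ∉ W := by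
  unfold edge
  split_ifs with h <;> simp

theorem card_eq_one_or_five {W : Finset (Fin 7)} (h : W.card % 4 = 1) :
    W.card = 1 ∨ W.card = 5 := by
  have h2 := Finset.card_le_univ W
  rw [Fintype.card_fin] at h2
  omega

theorem card_edge {W : Finset (Fin 7)} (h : W.card % 4 = 1) : (edge W).card = 2 := by
  rcases card_eq_one_or_five h with h1 | h1
  · rw [edge, if_pos h1, Finset.card_insertNone, h1]
  · rw [edge, if_neg (by omega), Finset.card_map, Finset.card_compl, h1, Fintype.card_fin]

/-- Two singletons are disjoint, and their edges share only the additional vertex. A singleton lies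
outside the five-element set, so its element is the common vertex. Two five-element sets meet in at
least 3 elements, hence in 4, and miss exactly one common element. -/
theorem card_edge_inter_edge {W W' : Finset (Fin 7)} (h : W.card % 4 = 1) (h' : W'.card % 4 = 1)
    (he : Even (W ∩ W').card) : (edge W ∩ edge W').card = 1 := by
  wlog hle : W.card ≤ W'.card generalizing W W'
  · rw [Finset.inter_comm]
    exact this h' h (by rwa [Finset.inter_comm]) (by omega)
  rw [Nat.even_iff] at he
  have hi := Finset.card_le_card (Finset.inter_subset_left (s₁ := W) (s₂ := W'))
  have hu := Finset.card_union_add_card_inter W W'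
  have hu7 := Finset.card_le_univ (W ∪ W')
  rw [Fintype.card_fin] at hu7
  rcases card_eq_one_or_five h with h1 | h1 <;> rcases card_eq_one_or_five h' with h1' | h1'
  · have : edge W ∩ edge W' = (W ∩ W').insertNone := by
      ext (_ | a) <;> simp [none_mem_edge, some_mem_edge, h1, h1']
    rw [this, Finset.card_insertNone]
    omega
  · have : edge W ∩ edge W' = (W \ W').map Function.Embedding.some := by
      ext (_ | a) <;> simp [none_mem_edge, some_mem_edge, h1, h1']
    rw [this, Finset.card_map]
    have := Finset.card_sdiff_add_card_inter W W'
    omega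
  · omega
  · have : edge W ∩ edge W' = (W ∪ W')ᶜ.map Function.Embedding.some := by
      ext (_ | a) <;> simp [none_mem_edge, some_mem_edge, h1, h1']
    rw [this, Finset.card_map, Finset.card_compl, Fintype.card_fin]
    omega

theorem index_range_boundaryMap_seven :
    (boundaryMap (form 7 ε) (form_nondegenerate 7 ε)).range.index = 8 := by
  let 𝒲 : Option (Fin 7) → Set (Finset (Fin 7)) := fun v => {W | W.card % 4 = 1 ∧ v ∈ edge W}
  rw [index_range_boundaryMap (n := 6) ε (by norm_num) 𝒲, Nat.card_eq_fintype_card,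
    Fintype.card_option, Fintype.card_fin]
  · have key (v : Option (Fin 7)) (b : Fin 7) :
        intClass ε (Pi.single b 1) ∈ frame ε (𝒲 v) ↔ v = none ∨ v = some b := by
      rw [intClass_mem_frame_iff, oddSupp_single]
      cases v <;> simp [𝒲, none_mem_edge, some_mem_edge]
    intro k l hkl
    have h : frame ε (𝒲 k) = frame ε (𝒲 l) := hkl
    have h' (b : Fin 7) : (k = none ∨ k = some b) ↔ (l = none ∨ l = some b) := by
      rw [← key, ← key, h]
    -- The star at the additional vertex contains all the singletons and every other star only one,
    -- so two singletons suffice to tell them apart.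
    have h0 := h' 0
    have h1 := h' 1
    rcases k with _ | a <;> rcases l with _ | b
    · rfl
    · simp at h0 h1
      omega
    · simp at h0 h1
      omega
    · simpa using h' b
  · rintro (_ | a)
    · refine ⟨1, (one_smul _ _).trans ?_⟩
      have : 𝒲 none = {W | W.card = 1} := by
        ext W
        simp only [𝒲, none_mem_edge, Set.mem_ofPred_eq]
        omega
      rw [this]
      rfl
    · have hmem {W : Finset (Fin 7)} (ha : a ∈ W) : W ∩ {a}ᶜ = W.erase a := by
        ext b; simp [and_comm]
      have hnot {W : Finset (Fin 7)} (ha : a ∉ W) : W ∩ {a}ᶜ = W := by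
        rw [Finset.inter_eq_left, Finset.subset_compl_singleton]
        exact ha
      have hsymm {W : Finset (Fin 7)} (ha : a ∉ W) : symmDiff W {a}ᶜ = (insert a W)ᶜ := by
        ext b
        by_cases hb : b = a
        · simp [Finset.mem_symmDiff, hb, ha]
        · simp [Finset.mem_symmDiff, hb]
      -- On the edges this transvection is the transposition of `a` and the additional vertex: it
      -- fixes `{a}` and exchanges `{b}` with the complement of `{a, b}`.
      refine exists_smul_unitFrame_eq ε {a}ᶜ (by simp [Finset.card_compl]) ?_ ?_
      · rintro W ⟨hc, hW⟩
        rw [some_mem_edge] at hW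
        rcases card_eq_one_or_five hc with h1 | h1
        · rw [if_pos h1] at hW
          simp [hmem hW, h1, hW]
        · rw [if_neg (by omega)] at hW
          simp [hnot hW, hsymm hW, h1, Finset.card_compl, hW, Nat.even_iff]
      · intro W hW
        by_cases ha : a ∈ W
        · simp [hmem ha, hW, ha, 𝒲, some_mem_edge]
        · simp [hnot ha, hsymm ha, hW, ha, 𝒲, some_mem_edge, Finset.card_compl]
  · intro f
    obtain ⟨u, hu, hc, he⟩ := exists_oddSupp_of_aut ε (by norm_num) f
    obtain ⟨v, hv⟩ := exists_common_mem (by simp) (fun i => edge (oddSupp (u i)))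
      (fun i => card_edge (hc i)) (fun i j hij => card_edge_inter_edge (hc i) (hc j) (he i j hij))
    exact ⟨v, smul_unitFrame_subset ε f u hu fun i => ⟨hc i, hv i⟩⟩

end BoundaryForms

end

theorem mainTheorem4 (ε : ℤˣ) :
    (Nontrivial (BoundaryForms.BAut (BoundaryForms.form 6 ε)
        (BoundaryForms.form_nondegenerate 6 ε)) ∧
      ¬ Function.Surjective (BoundaryForms.boundaryMap (BoundaryForms.form 6 ε)
        (BoundaryForms.form_nondegenerate 6 ε)) ∧
      (BoundaryForms.boundaryMap (BoundaryForms.form 6 ε)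
        (BoundaryForms.form_nondegenerate 6 ε)).range.index = 2) ∧
    (Nontrivial (BoundaryForms.BAut (BoundaryForms.form 7 ε)
        (BoundaryForms.form_nondegenerate 7 ε)) ∧
      ¬ Function.Surjective (BoundaryForms.boundaryMap (BoundaryForms.form 7 ε)
        (BoundaryForms.form_nondegenerate 7 ε)) ∧
      (BoundaryForms.boundaryMap (BoundaryForms.form 7 ε)
        (BoundaryForms.form_nondegenerate 7 ε)).range.index = 8) := by
  have h6 := BoundaryForms.index_range_boundaryMap_six ε
  have h7 := BoundaryForms.index_range_boundaryMap_seven ε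
  have s6 := BoundaryForms.not_surjective_of_index_range _ (h6.trans_ne (by norm_num))
  have s7 := BoundaryForms.not_surjective_of_index_range _ (h7.trans_ne (by norm_num))
  exact ⟨⟨BoundaryForms.nontrivial_bAut_of_not_surjective _ _ s6, s6, h6⟩,
    BoundaryForms.nontrivial_bAut_of_not_surjective _ _ s7, s7, h7⟩
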